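/- Let $X$ be a countable set (with the discrete $\sigma$-algebra; $\{0,1\}^X$ carries the product $\sigma$-algebra) and let $\mathcal H\subseteq\{0,1\}^X$. An $n$-sample learning rule $A$ maps each sample $S\in(X\times\{0,1\})^n$ to a probability measure $A(S)$ on $\{0,1\}^X$. For a probability measure $D$ on $X\times\{0,1\}$ put $\mathrm{err}_D(h)=\Pr_{(x,y)\sim D}[h(x)\neq y]$, and call $D$ realizable if $\mathrm{err}_D(h^*)=0$ for some $h^*\in\mathcal H$. The rule $A$ is an $(\alpha,\beta)$-accurate learner for $\mathcal H$ if for every realizable $D$ $$\Pr_{S\sim D^n,\ h\sim A(S)}\left[\mathrm{err}_D(h)>\alpha\right]\le\beta .$$ Such a learner is $\rho$-TV indistinguishable if for every realizable $D$ $$\mathbb E_{S,S'\sim D^n}\left[d_{\mathrm{TV}}(A(S),A(S'))\right]\le\rho\qquad(S,S'\text{ independent}),$$ where $d_{\mathrm{TV}}(P,Q)=\sup_E (P(E)-Q(E))$ over measurable $E$. The rule $A$ is $(\varepsilon,\delta)$-differentially private if for all samples $S,S'$ that differ in a single example and all measurable $E\subseteq\{0,1\}^X$, $A(S)(E)\le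 e^{\varepsilon}A(S')(E)+\delta$ and $A(S')(E)\le e^{\varepsilon}A(S)(E)+\delta$. **Theorem (TV indistinguishability $\Rightarrow$ $(\varepsilon,\delta)$-DP).** For all $\rho\in(0,1)$ and $\beta\in\left(0,\frac{1-\rho}{1+\rho}\right)$ there is a constant $C=C(\beta,\rho)>0$ such that the following holds. Let $X$ be countable, $\mathcal H\subseteq\{0,1\}^X$, $\alpha\in(0,1/2)$ and $n\ge 1$, and suppose that $\mathcal H$ has an $n$-sample $(\alpha,\beta)$-accurate $\rho$-TV indistinguishable learner. Then for all $\alpha',\beta',\varepsilon,\delta\in(0,1)$ there are a sample size $$n_{\mathrm{DP}}\ \le\ C\left(\frac{\log\frac{3}{\beta'}\cdot\log\frac{\log(3/\beta')}{\beta'\delta}}{\varepsilon}+\log\frac{\log(3/\beta')}{\beta'}\cdot\max\left\{\frac1{\varepsilon\alpha'},\frac1{\alpha'^2}\right\}\right)\cdot n$$ and an $n_{\mathrm{DP}}$-sample $(\alpha+\alpha',\beta')$-accurate $(\varepsilon,\delta)$-differentially private learner for $\mathcal H$. -/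

import Mathlib

open MeasureTheory ProbabilityTheory Set

noncomputable section

namespace PrivateLearning

variable {X : Type*} [MeasurableSpace X]

/-- A sample: a sequence of `n` labelled examples. -/
abbrev Sample (X : Type*) (n : ℕ) : Type _ := Fin n → X × Bool

/-- An `n`-sample randomized learning rule: it maps a sample to a probability measure on the
binary classifiers (with the product σ-algebra). Over a countable discrete domain every map
from samples to probability measures is such a kernel. -/
structure LearningRule (X : Type*) [MeasurableSpace X] (n : ℕ) where
  /-- the posterior distribution of the rule on each sample -/
  posterior : Kernel (Sample X n) (X → Bool)
  isMarkov : IsMarkovKernel posterior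

attribute [instance] LearningRule.isMarkov

/-- The law of a sample of `n` i.i.d. examples drawn from `D`. -/
def sampleLaw (D : Measure (X × Bool)) (n : ℕ) : Measure (Sample X n) :=
  Measure.pi fun _ => D

/-- The misclassification probability of the classifier `h` under `D`. -/
def err (D : Measure (X × Bool)) (h : X → Bool) : ℝ :=
  D.real {z | h z.1 ≠ z.2}

/-- `D` is realizable with respect to the class `H`. -/
def Realizable (H : Set (X → Bool)) (D : Measure (X × Bool)) : Prop :=
  ∃ h ∈ H, err D h = 0

/-- Total variation distance of two probability measures: the supremum of `P E - Q E` over all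
measurable events `E`. -/
def tvDist {Ω : Type*} [MeasurableSpace Ω] (P Q : Measure Ω) : ℝ :=
  ⨆ E : {E : Set Ω // MeasurableSet E}, (P.real E - Q.real E)

/-- The supremum in `tvDist` is over a bounded set. -/
theorem tvDist_bddAbove {Ω : Type*} [MeasurableSpace Ω] (P Q : Measure Ω)
    [IsProbabilityMeasure P] :
    BddAbove (range fun E : {E : Set Ω // MeasurableSet E} => P.real E - Q.real E) := by
  refine ⟨1, ?_⟩
  rintro _ ⟨E, rfl⟩
  have h1 : P.real (E : Set Ω) ≤ 1 := measureReal_le_one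
  have h2 : 0 ≤ Q.real (E : Set Ω) := measureReal_nonneg
  simp only
  linarith

/-- `A` is `ρ`-TV indistinguishable with respect to `D`: for two independent samples
`S, S' ∼ Dⁿ` the expected total variation distance of `A(S)` and `A(S')` is at most `ρ`. -/
def TVIndistinguishable {n : ℕ} (A : LearningRule X n) (ρ : ℝ) (D : Measure (X × Bool)) : Prop :=
  ∫ p, tvDist (A.posterior p.1) (A.posterior p.2) ∂((sampleLaw D n).prod (sampleLaw D n)) ≤ ρ

/-- `A` is `(α, β)`-accurate for `D`: the output `h ∼ A(S)`, `S ∼ Dⁿ`, has misclassification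
probability greater than `α` with probability at most `β`, over both the sample and the
randomness of the rule. -/
def Accurate {n : ℕ} (A : LearningRule X n) (α β : ℝ) (D : Measure (X × Bool)) : Prop :=
  ((sampleLaw D n).bind A.posterior).real {h | α < err D h} ≤ β

/-- `A` is an `(α, β)`-accurate `ρ`-TV indistinguishable learner for `H`, in the realizable
setting. -/
def IsTVLearner {n : ℕ} (H : Set (X → Bool)) (A : LearningRule X n) (α β ρ : ℝ) : Prop :=
  ∀ D : Measure (X × Bool), IsProbabilityMeasure D → Realizable H D →
    TVIndistinguishable A ρ D ∧ Accurate A α β D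

/-- `P` and `Q` are `(ε, δ)`-indistinguishable. -/
def DPIndistinguishable {Ω : Type*} [MeasurableSpace Ω] (ε δ : ℝ) (P Q : Measure Ω) : Prop :=
  ∀ E, MeasurableSet E →
    P.real E ≤ Real.exp ε * Q.real E + δ ∧ Q.real E ≤ Real.exp ε * P.real E + δ

/-- `A` is `(ε, δ)`-differentially private: the posteriors of any two samples that differ in a
single example are `(ε, δ)`-indistinguishable. -/
def DifferentiallyPrivate {n : ℕ} (A : LearningRule X n) (ε δ : ℝ) : Prop :=
  ∀ S S' : Sample X n, (∃ i, ∀ j, j ≠ i → S j = S' j) →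
    DPIndistinguishable ε δ (A.posterior S) (A.posterior S')

/-- `A` is an `(α, β)`-accurate `(ε, δ)`-differentially private learner for `H`, in the
realizable setting. -/
def IsDPLearner {n : ℕ} (H : Set (X → Bool)) (A : LearningRule X n) (α β ε δ : ℝ) : Prop :=
  DifferentiallyPrivate A ε δ ∧
    ∀ D : Measure (X × Bool), IsProbabilityMeasure D → Realizable H D → Accurate A α β D

/-- The blow-up of the sample complexity, up to a factor that depends only on the confidence
and indistinguishability parameters of the given learner:
`log(3/β) · log(log(3/β)/(βδ)) / ε + log(log(3/β)/β) · max {1/(εα), 1/α²}`. -/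
def sampleBlowup (α β ε δ : ℝ) : ℝ :=
  Real.log (3 / β) * Real.log (Real.log (3 / β) / (β * δ)) / ε +
    Real.log (Real.log (3 / β) / β) * max (1 / (ε * α)) (1 / α ^ 2)

end PrivateLearning

end

/-! Over a countable domain there are only countably many samples, so all posteriors have densities
against one finite measure, and `A(S)` can be encoded as the region under its density: a set of base
measure one whose projection to the classifiers is distributed as `A(S)`. Two regions overlap in
measure at least one minus the total variation distance. Hence, if `cover` at a point is the
probability that the region of a random sample contains it, then ∫ cover = 1 while ∫ cover² ≥ 1 - ρ.
Points of cover below κ contribute at most κ to the second integral, and points over inaccurate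
classifiers at most β. With 2κ = 1 - ρ - β, the heavily covered points over accurate classifiers
therefore have measure at least κ (`le_measure_heavy`). Here κ > 0, because (1 - ρ)/(1 + ρ) ≤ 1 - ρ.

With probability at least 1/2, a heavy point lies in at least κT/4 of the regions of T fresh
samples. The private mechanism outputs a point with a density that depends only on this count and
that changes, per region, by a factor e^{2η} up to an additive O(a) (`countWeight_succ_le`). One
example affects one region, so T of order log(1/δ)/(κε) gives privacy (`dpLe_batchMechanism`)
together with success probability κ²/16 (`le_lintegral_batchRule`).

The confidence is boosted with O(log(3/β')) disjoint batches, whose outputs compete in an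
exponential mechanism on a separate validation sample (`lintegral_select_le`). Each example belongs
to a single batch or to the validation part, so privacy does not degrade with the number of batches.
-/

open MeasureTheory ProbabilityTheory Set
open scoped ENNReal

noncomputable section

namespace PrivateLearning

/-! ### Posteriors as regions under densities, and heavily covered points -/

section Hypograph

variable {I Ω : Type*} [Countable I] [MeasurableSpace Ω]

/-- A finite measure dominating every measure of a countable family. -/
def refMeasure (P : I → Measure Ω) [∀ i, IsProbabilityMeasure (P i)] : Measure Ω :=
  (Measure.sum P).toFinite

/-- The product of the reference measure and the Lebesgue measure on the positive half line. -/
def baseMeasure (P : I → Measure Ω) [∀ i, IsProbabilityMeasure (P i)] : Measure (Ω × ℝ) :=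
  (refMeasure P).prod (volume.restrict (Ioi 0))

/-- The region under the graph of the density of `P i`. -/
def hypograph (P : I → Measure Ω) [∀ i, IsProbabilityMeasure (P i)] (i : I) : Set (Ω × ℝ) :=
  {y | ENNReal.ofReal y.2 < (P i).rnDeriv (refMeasure P) y.1}

variable (P : I → Measure Ω) [∀ i, IsProbabilityMeasure (P i)]

instance : IsFiniteMeasure (refMeasure P) := by unfold refMeasure; infer_instance

instance : SFinite (baseMeasure P) := by unfold baseMeasure; infer_instance

theorem absolutelyContinuous_refMeasure (i : I) : P i ≪ refMeasure P :=
  (Measure.le_sum P i).absolutelyContinuous.trans (absolutelyContinuous_toFinite _)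

theorem measurableSet_hypograph (i : I) : MeasurableSet (hypograph P i) :=
  measurableSet_lt (by fun_prop) ((Measure.measurable_rnDeriv _ _).comp measurable_fst)

theorem volume_setOf_ofReal_lt (d : ℝ≥0∞) :
    volume.restrict (Ioi (0 : ℝ)) {u | ENNReal.ofReal u < d} = d := by
  rw [Measure.restrict_apply (measurableSet_lt (by fun_prop) measurable_const)]
  by_cases hd : d = ∞
  · subst hd
    simp
  · have : {u : ℝ | ENNReal.ofReal u < d} ∩ Ioi 0 = Ioo 0 d.toReal := by
      ext u
      simp only [mem_inter_iff, mem_ofPred_eq, mem_Ioi, mem_Ioo]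
      constructor
      · rintro ⟨h1, h2⟩
        exact ⟨h2, (ENNReal.ofReal_lt_iff_lt_toReal h2.le hd).1 h1⟩
      · rintro ⟨h1, h2⟩
        exact ⟨(ENNReal.ofReal_lt_iff_lt_toReal h1.le hd).2 h2, h1⟩
    rw [this, Real.volume_Ioo, sub_zero, ENNReal.ofReal_toReal hd]

/-- By Fubini: the fibre of the region over a classifier has length equal to the density there. -/
theorem baseMeasure_hypograph_inter (i : I) {E : Set Ω} (hE : MeasurableSet E) :
    baseMeasure P (hypograph P i ∩ Prod.fst ⁻¹' E) = P i E := by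
  rw [baseMeasure, Measure.prod_apply ((measurableSet_hypograph P i).inter (measurable_fst hE))]
  conv_rhs => rw [← Measure.withDensity_rnDeriv_eq _ _ (absolutelyContinuous_refMeasure P i),
    withDensity_apply _ hE, ← lintegral_indicator hE]
  refine lintegral_congr fun h => ?_
  by_cases hh : h ∈ E
  · simp only [hh, indicator_of_mem]
    rw [← volume_setOf_ofReal_lt ((P i).rnDeriv (refMeasure P) h)]
    congr 1
    ext u
    simp [hypograph, hh]
  · have : Prod.mk h ⁻¹' (hypograph P i ∩ Prod.fst ⁻¹' E) = (∅ : Set ℝ) := by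
      ext u
      simp [hh]
    simp [this, hh]

theorem baseMeasure_hypograph (i : I) : baseMeasure P (hypograph P i) = 1 := by
  simpa using baseMeasure_hypograph_inter P i MeasurableSet.univ

/-- The overlap of two hypographs is one minus the total variation distance. -/
theorem one_sub_tvDist_le_overlap (i j : I) :
    ENNReal.ofReal (1 - tvDist (P i) (P j)) ≤
      baseMeasure P (hypograph P i ∩ hypograph P j) := by
  set E : Set Ω := {h | (P j).rnDeriv (refMeasure P) h < (P i).rnDeriv (refMeasure P) h}
  have hE : MeasurableSet E :=
    measurableSet_lt (Measure.measurable_rnDeriv _ _) (Measure.measurable_rnDeriv _ _)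
  have hmem : ∀ y : Ω × ℝ, y.1 ∈ E ↔
      (P j).rnDeriv (refMeasure P) y.1 < (P i).rnDeriv (refMeasure P) y.1 := fun y => Iff.rfl
  have hhyp : ∀ l, ∀ y : Ω × ℝ, y ∈ hypograph P l ↔
      ENNReal.ofReal y.2 < (P l).rnDeriv (refMeasure P) y.1 := fun l y => Iff.rfl
  -- Over `E` the region of `j` lies inside that of `i`, and over the complement the inclusion is
  -- reversed. The overlap thus has measure at least P_i(Eᶜ) + P_j(E) = 1 - (P_i(E) - P_j(E)).
  have hsub : (hypograph P i ∩ Prod.fst ⁻¹' Eᶜ) ∪ (hypograph P j ∩ Prod.fst ⁻¹' E) ⊆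
      hypograph P i ∩ hypograph P j := by
    rintro y (⟨h1, h2⟩ | ⟨h1, h2⟩)
    · refine ⟨h1, (hhyp j y).2 (lt_of_lt_of_le ((hhyp i y).1 h1) (not_lt.1 fun h => ?_))⟩
      exact h2 ((hmem y).2 h)
    · exact ⟨(hhyp i y).2 (lt_trans ((hhyp j y).1 h1) ((hmem y).1 h2)), h1⟩
  have hdisj : Disjoint (hypograph P i ∩ Prod.fst ⁻¹' Eᶜ) (hypograph P j ∩ Prod.fst ⁻¹' E) := by
    rw [Set.disjoint_left]
    rintro y ⟨_, h1⟩ ⟨_, h2⟩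
    exact h1 h2
  refine le_trans ?_ (measure_mono hsub)
  rw [measure_union hdisj ((measurableSet_hypograph P j).inter (measurable_fst hE)),
    baseMeasure_hypograph_inter P i hE.compl, baseMeasure_hypograph_inter P j hE]
  have h1 : (P i).real E - (P j).real E ≤ tvDist (P i) (P j) :=
    le_ciSup (tvDist_bddAbove (P i) (P j)) ⟨E, hE⟩
  have h2 : (P i).real Eᶜ = 1 - (P i).real E := probReal_compl_eq_one_sub hE
  rw [← ofReal_measureReal (μ := P i), ← ofReal_measureReal (μ := P j),
    ← ENNReal.ofReal_add measureReal_nonneg measureReal_nonneg]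
  exact ENNReal.ofReal_le_ofReal (by linarith)

omit [Countable I] in
theorem tvDist_mem_Icc (i j : I) : tvDist (P i) (P j) ∈ Icc (0 : ℝ) 1 := by
  constructor
  · have := le_ciSup (tvDist_bddAbove (P i) (P j)) ⟨∅, MeasurableSet.empty⟩
    simpa [tvDist] using this
  · have : Nonempty {E : Set Ω // MeasurableSet E} := ⟨⟨∅, MeasurableSet.empty⟩⟩
    refine ciSup_le fun E => ?_
    have h1 : (P i).real (E : Set Ω) ≤ 1 := measureReal_le_one
    have h2 : 0 ≤ (P j).real (E : Set Ω) := measureReal_nonneg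
    linarith

variable [MeasurableSpace I] [MeasurableSingletonClass I]

/-- The probability that the hypograph of a random index contains `y`. -/
def cover (L : Measure I) (y : Ω × ℝ) : ℝ≥0∞ := L {i | y ∈ hypograph P i}

theorem measurableSet_mem_hypograph : MeasurableSet {p : I × (Ω × ℝ) | p.2 ∈ hypograph P p.1} := by
  have : {p : I × (Ω × ℝ) | p.2 ∈ hypograph P p.1} = ⋃ i, {i} ×ˢ hypograph P i := by
    ext ⟨i, y⟩
    simp
  rw [this]
  exact .iUnion fun i => (measurableSet_singleton i).prod (measurableSet_hypograph P i)

theorem measurable_cover (L : Measure I) [SFinite L] : Measurable (cover P L) :=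
  measurable_measure_prodMk_right (measurableSet_mem_hypograph P)

theorem lintegral_cover (L : Measure I) [IsProbabilityMeasure L] (F : Set (Ω × ℝ)) :
    ∫⁻ y in F, cover P L y ∂(baseMeasure P) = ∫⁻ i, baseMeasure P (hypograph P i ∩ F) ∂L := by
  have h1 := Measure.prod_apply (μ := L) (ν := (baseMeasure P).restrict F)
    (measurableSet_mem_hypograph P)
  have h2 := Measure.prod_apply_symm (μ := L) (ν := (baseMeasure P).restrict F)
    (measurableSet_mem_hypograph P)
  calc _ = _ := h2.symm
    _ = _ := h1
    _ = _ := lintegral_congr fun i => Measure.restrict_apply (measurableSet_hypograph P i)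

/-- The square of the cover is the probability that two independent regions both contain the point;
Tonelli turns its integral into the mean overlap. -/
theorem lintegral_cover_sq (L : Measure I) [IsProbabilityMeasure L] (F : Set (Ω × ℝ)) :
    ∫⁻ y in F, cover P L y * cover P L y ∂(baseMeasure P) =
      ∫⁻ i, ∫⁻ j, baseMeasure P (hypograph P i ∩ hypograph P j ∩ F) ∂L ∂L := by
  have h : ∀ i, ∫⁻ j, baseMeasure P (hypograph P i ∩ hypograph P j ∩ F) ∂L =
      ∫⁻ y in F, (hypograph P i).indicator (cover P L) y ∂(baseMeasure P) := by
    intro i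
    rw [lintegral_indicator (measurableSet_hypograph P i), Measure.restrict_restrict
      (measurableSet_hypograph P i), lintegral_cover P L]
    refine lintegral_congr fun j => ?_
    congr 1
    ext y
    simp only [mem_inter_iff]
    tauto
  simp_rw [h]
  rw [lintegral_lintegral_swap]
  · refine lintegral_congr fun y => ?_
    have : ∀ i, (hypograph P i).indicator (cover P L) y =
        {i | y ∈ hypograph P i}.indicator (fun _ => cover P L y) i := by
      intro i
      simp [indicator]
    simp_rw [this]
    rw [lintegral_indicator_const (DiscreteMeasurableSpace.forall_measurableSet _)]
    rfl
  · refine (measurable_from_prod_countable_right fun i => ?_).aemeasurable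
    exact (measurable_cover P L).indicator (measurableSet_hypograph P i)

/-- If two independent random members of the family have small total variation distance on
average, and a random member rarely falls outside `G`, then the heavily covered part of the
cylinder over `G` has large measure. -/
theorem le_measure_heavy (L : Measure I) [IsProbabilityMeasure L] {ρ β κ : ℝ} {G : Set Ω}
    (hG : MeasurableSet G)
    (htv : ∫ p, tvDist (P p.1) (P p.2) ∂(L.prod L) ≤ ρ)
    (hacc : ∫⁻ i, P i Gᶜ ∂L ≤ ENNReal.ofReal β) :
    ENNReal.ofReal (1 - ρ) ≤ baseMeasure P
      ({y | ENNReal.ofReal κ ≤ cover P L y} ∩ Prod.fst ⁻¹' G) + ENNReal.ofReal κ +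
        ENNReal.ofReal β := by
  have hC : MeasurableSet {y | ENNReal.ofReal κ ≤ cover P L y} :=
    measurableSet_le measurable_const (measurable_cover P L)
  have hint : Integrable (fun p : I × I => tvDist (P p.1) (P p.2)) (L.prod L) := by
    refine Integrable.of_bound (C := 1) Measurable.of_discrete.aestronglyMeasurable
      (.of_forall fun p => ?_)
    have := tvDist_mem_Icc P p.1 p.2
    rw [Real.norm_eq_abs, abs_of_nonneg this.1]
    exact this.2
  have h1 : ENNReal.ofReal (1 - ρ) ≤
      ∫⁻ p : I × I, baseMeasure P (hypograph P p.1 ∩ hypograph P p.2) ∂(L.prod L) := by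
    calc ENNReal.ofReal (1 - ρ)
        ≤ ENNReal.ofReal (∫ p, (1 - tvDist (P p.1) (P p.2)) ∂(L.prod L)) := by
          rw [integral_sub (integrable_const _) hint]
          refine ENNReal.ofReal_le_ofReal ?_
          simp only [integral_const, probReal_univ, smul_eq_mul, mul_one]
          linarith
      _ = ∫⁻ p, ENNReal.ofReal (1 - tvDist (P p.1) (P p.2)) ∂(L.prod L) :=
          ofReal_integral_eq_lintegral_ofReal ((integrable_const _).sub hint)
            (.of_forall fun p => sub_nonneg.2 (tvDist_mem_Icc P p.1 p.2).2)
      _ ≤ _ := lintegral_mono fun p => one_sub_tvDist_le_overlap P p.1 p.2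
  have h2 : ∫⁻ p : I × I, baseMeasure P (hypograph P p.1 ∩ hypograph P p.2) ∂(L.prod L) =
      ∫⁻ y, cover P L y * cover P L y ∂(baseMeasure P) := by
    rw [lintegral_prod _ Measurable.of_discrete.aemeasurable]
    simpa using (lintegral_cover_sq P L univ).symm
  have hc1 : ∀ y, cover P L y ≤ 1 := fun y => prob_le_one
  -- Since cover ≤ 1, its square is at most 1 on heavy points over `G`, at most κ · cover on light
  -- points, and at most cover outside `G`. These three bounds integrate to the three terms of the
  -- claim.
  have h3 : ∀ y, cover P L y * cover P L y ≤
      ({y | ENNReal.ofReal κ ≤ cover P L y} ∩ Prod.fst ⁻¹' G).indicator 1 y +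
        ENNReal.ofReal κ * cover P L y +
        (Prod.fst ⁻¹' Gᶜ).indicator (cover P L) y := by
    intro y
    by_cases hy : y.1 ∈ G
    · by_cases hk : ENNReal.ofReal κ ≤ cover P L y
      · refine le_trans (mul_le_one' (hc1 y) (hc1 y)) ?_
        simp only [indicator, mem_inter_iff, mem_ofPred_eq, hk, mem_preimage, hy, and_self,
          if_true, Pi.one_apply]
        exact le_trans le_self_add le_self_add
      · refine le_trans (mul_le_mul_left (not_le.1 hk).le _) ?_
        exact le_trans le_add_self le_self_add
    · have : (Prod.fst ⁻¹' Gᶜ : Set (Ω × ℝ)).indicator (cover P L) y = cover P L y := by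
        simp [indicator, hy]
      rw [this]
      exact le_trans (mul_le_of_le_one_left' (hc1 y)) le_add_self
  refine h1.trans (h2.le.trans ((lintegral_mono h3).trans ?_))
  rw [lintegral_add_right _ ((measurable_cover P L).indicator (measurable_fst hG.compl)),
    lintegral_add_right _ ((measurable_cover P L).const_mul _),
    lintegral_indicator_one (hC.inter (measurable_fst hG)),
    lintegral_const_mul _ (measurable_cover P L), lintegral_indicator (measurable_fst hG.compl),
    lintegral_cover P L]
  have h4 : ∫⁻ y, cover P L y ∂(baseMeasure P) = 1 := by
    simpa [baseMeasure_hypograph] using lintegral_cover P L univ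
  rw [h4, mul_one]
  gcongr
  refine le_trans (le_of_eq (lintegral_congr fun i => ?_)) hacc
  exact baseMeasure_hypograph_inter P i hG.compl

end Hypograph

/-! ### Approximate indistinguishability of measures -/

/-- One-sided approximate indistinguishability, tested against functions with values in `[0, 1]`. -/
def DPLe {Ω : Type*} [MeasurableSpace Ω] (e d : ℝ≥0∞) (P Q : Measure Ω) : Prop :=
  ∀ g : Ω → ℝ≥0∞, Measurable g → (∀ x, g x ≤ 1) → ∫⁻ x, g x ∂P ≤ e * ∫⁻ x, g x ∂Q + d

theorem DPLe.trans {Ω : Type*} [MeasurableSpace Ω] {e₁ d₁ e₂ d₂ : ℝ≥0∞} {P Q U : Measure Ω}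
    (h₁ : DPLe e₁ d₁ P Q) (h₂ : DPLe e₂ d₂ Q U) : DPLe (e₁ * e₂) (e₁ * d₂ + d₁) P U := by
  intro g hg hg1
  calc _ ≤ e₁ * ∫⁻ x, g x ∂Q + d₁ := h₁ g hg hg1
    _ ≤ e₁ * (e₂ * ∫⁻ x, g x ∂U + d₂) + d₁ := by gcongr; exact h₂ g hg hg1
    _ = _ := by ring

theorem DPLe.mono {Ω : Type*} [MeasurableSpace Ω] {e d e' d' : ℝ≥0∞} {P Q : Measure Ω}
    (h : DPLe e d P Q) (he : e ≤ e') (hd : d ≤ d') : DPLe e' d' P Q := fun g hg hg1 =>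
  (h g hg hg1).trans (by gcongr)

/-- Approximate indistinguishability is preserved when one factor of a product is changed. -/
theorem DPLe.pi {Ω : Type*} [MeasurableSpace Ω] {k : ℕ} {e d : ℝ≥0∞}
    {P Q : Fin (k + 1) → Measure Ω} [∀ i, IsProbabilityMeasure (P i)]
    [∀ i, IsProbabilityMeasure (Q i)] (i : Fin (k + 1)) (hi : DPLe e d (P i) (Q i))
    (hne : ∀ j, j ≠ i → P j = Q j) : DPLe e d (Measure.pi P) (Measure.pi Q) := by
  intro g hg hg1
  -- Coordinate `i` is integrated first, so that the hypothesis applies on each slice where the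
  -- other coordinates are fixed.
  have key : ∀ R : Fin (k + 1) → Measure Ω, (∀ j, IsProbabilityMeasure (R j)) →
      ∫⁻ x, g x ∂(Measure.pi R) = ∫⁻ y, ∫⁻ x, g ((MeasurableEquiv.piFinSuccAbove
        (fun _ => Ω) i).symm (x, y)) ∂(R i) ∂(Measure.pi fun j => R (i.succAbove j)) := by
    intro R hR
    rw [← lintegral_prod_symm (f := fun z => g ((MeasurableEquiv.piFinSuccAbove
      (fun _ => Ω) i).symm z)) (hg.comp (MeasurableEquiv.measurable _)).aemeasurable]
    exact ((measurePreserving_piFinSuccAbove R i).symm.lintegral_comp hg).symm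
  rw [key P inferInstance, key Q inferInstance]
  have hrest : (Measure.pi fun j => P (i.succAbove j)) = Measure.pi fun j => Q (i.succAbove j) := by
    congr 1
    funext j
    exact hne _ (i.succAbove_ne j)
  rw [hrest]
  have hm : Measurable fun z : Ω × (Fin k → Ω) => g ((MeasurableEquiv.piFinSuccAbove
      (fun _ => Ω) i).symm z) := hg.comp (MeasurableEquiv.measurable _)
  calc _ ≤ ∫⁻ y, (e * ∫⁻ x, g ((MeasurableEquiv.piFinSuccAbove
        (fun _ => Ω) i).symm (x, y)) ∂(Q i) + d) ∂(Measure.pi fun j => Q (i.succAbove j)) :=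
        lintegral_mono fun y => hi _ (hm.comp (by fun_prop)) fun x => hg1 _
    _ = _ := by
        have : Measurable fun y : Fin k → Ω => ∫⁻ x, g ((MeasurableEquiv.piFinSuccAbove
            (fun _ => Ω) i).symm (x, y)) ∂(Q i) :=
          (hm.comp measurable_swap).lintegral_prod_right'
        rw [lintegral_add_right _ measurable_const, lintegral_const_mul _ this]
        simp

/-! ### Releasing a point from a subprobability density -/

section Release

variable {Y Ω : Type*} [MeasurableSpace Y] [MeasurableSpace Ω]

/-- Output `π y` with density `w y`, and the default `h₀` with the remaining probability. -/
def release (ν : Measure Y) (π : Y → Ω) (h₀ : Ω) (w : Y → ℝ≥0∞) : Measure Ω :=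
  (ν.withDensity w).map π + (1 - ∫⁻ y, w y ∂ν) • Measure.dirac h₀

variable {ν : Measure Y} {π : Y → Ω} {h₀ : Ω} {w w' : Y → ℝ≥0∞}

theorem lintegral_release (hπ : Measurable π) (hw : Measurable w) {g : Ω → ℝ≥0∞}
    (hg : Measurable g) : ∫⁻ x, g x ∂(release ν π h₀ w) =
      ∫⁻ y, w y * g (π y) ∂ν + (1 - ∫⁻ y, w y ∂ν) * g h₀ := by
  rw [release, lintegral_add_measure, lintegral_map hg hπ, lintegral_smul_measure,
    lintegral_dirac' _ hg, lintegral_withDensity_eq_lintegral_mul _ hw (g := fun y => g (π y)) (hg.comp hπ)]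
  rfl

theorem isProbabilityMeasure_release (hπ : Measurable π) (hw : Measurable w)
    (hw1 : ∫⁻ y, w y ∂ν ≤ 1) : IsProbabilityMeasure (release ν π h₀ w) := by
  constructor
  have := lintegral_release (h₀ := h₀) (ν := ν) hπ hw (g := fun _ => 1) measurable_const
  simp only [lintegral_const, one_mul, mul_one] at this
  rw [this]
  exact add_tsub_cancel_of_le hw1

theorem le_release (hπ : Measurable π) {G : Set Ω} (hG : MeasurableSet G) :
    ∫⁻ y in π ⁻¹' G, w y ∂ν ≤ release ν π h₀ w G := by
  rw [release, Measure.add_apply, Measure.map_apply hπ hG, withDensity_apply _ (hπ hG)]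
  exact le_self_add

variable {R : Set Y} {e d : ℝ≥0∞}

/-- Increasing the density by a bounded factor, plus a small constant on a set of measure one,
changes the released distribution little. -/
theorem dpLe_release (hπ : Measurable π) (hw : Measurable w) (hw' : Measurable w')
    (hR : MeasurableSet R) (hνR : ν R ≤ 1) (he : 1 ≤ e) (hle : ∀ y, w y ≤ w' y)
    (hup : ∀ y, w' y ≤ e * w y + R.indicator (fun _ => d) y) (hhalf : ∫⁻ y, w' y ∂ν ≤ 2⁻¹) :
    DPLe e d (release ν π h₀ w') (release ν π h₀ w) ∧
      DPLe e d (release ν π h₀ w) (release ν π h₀ w') := by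
  have hd : ∀ g : Y → ℝ≥0∞, (∀ y, g y ≤ 1) → ∫⁻ y, R.indicator (fun _ => d) y * g y ∂ν ≤ d := by
    intro g hg
    calc _ ≤ ∫⁻ y, R.indicator (fun _ => d) y ∂ν :=
          lintegral_mono fun y => mul_le_of_le_one_right' (hg y)
      _ = d * ν R := lintegral_indicator_const hR d
      _ ≤ d := mul_le_of_le_one_right' hνR
  have hint : ∀ g : Y → ℝ≥0∞, Measurable g → (∀ y, g y ≤ 1) →
      ∫⁻ y, w' y * g y ∂ν ≤ e * ∫⁻ y, w y * g y ∂ν + d := by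
    intro g hgm hg
    calc _ ≤ ∫⁻ y, (e * (w y * g y) + R.indicator (fun _ => d) y * g y) ∂ν := by
          refine lintegral_mono fun y => ?_
          rw [← mul_assoc, ← add_mul]
          exact mul_le_mul_left (hup y) _
      _ = e * ∫⁻ y, w y * g y ∂ν + ∫⁻ y, R.indicator (fun _ => d) y * g y ∂ν := by
          rw [lintegral_add_left (by fun_prop), lintegral_const_mul _ (by fun_prop)]
      _ ≤ _ := by gcongr; exact hd g hg
  have hmass : ∫⁻ y, w y ∂ν ≤ ∫⁻ y, w' y ∂ν := lintegral_mono hle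
  constructor
  · intro g hg hg1
    rw [lintegral_release hπ hw' hg, lintegral_release hπ hw hg, mul_add, add_right_comm]
    refine add_le_add (hint _ (hg.comp hπ) fun y => hg1 _) ?_
    refine le_trans ?_ (le_mul_of_one_le_left' he)
    gcongr
  · intro g hg hg1
    rw [lintegral_release hπ hw' hg, lintegral_release hπ hw hg, mul_add, add_assoc]
    refine add_le_add ?_ ?_
    · refine le_trans ?_ (le_mul_of_one_le_left' he)
      exact lintegral_mono fun y => mul_le_mul_left (hle y) _
    · have h2 : ∫⁻ y, w' y ∂ν ≤ e * ∫⁻ y, w y ∂ν + d := by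
        simpa using hint (fun _ => 1) measurable_const fun _ => le_rfl
      set W := ∫⁻ y, w y ∂ν
      set W' := ∫⁻ y, w' y ∂ν
      obtain ⟨t, rfl⟩ := exists_add_of_le he
      have hU : (1 - W') + W' = 1 := tsub_add_cancel_of_le (hhalf.trans (by norm_num))
      -- The default mass is at least 1/2, so it dominates the released mass. The increase of the
      -- default mass when `w'` drops to `w` can then be charged to it multiplicatively.
      have hU2 : W' ≤ 1 - W' := by
        refine hhalf.trans (le_trans ?_ (tsub_le_tsub_left hhalf 1))
        rw [ENNReal.one_sub_inv_two]
      have h3 : 1 - W ≤ (1 + t) * (1 - W') + d := by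
        rw [tsub_le_iff_right]
        calc (1 : ℝ≥0∞) = (1 - W') + W' := hU.symm
          _ ≤ (1 - W') + ((1 + t) * W + d) := by gcongr
          _ = (1 - W') + (t * W + d + W) := by ring
          _ ≤ (1 - W') + (t * (1 - W') + d + W) := by gcongr; exact hmass.trans hU2
          _ = _ := by ring
      calc (1 - W) * g h₀ ≤ ((1 + t) * (1 - W') + d) * g h₀ := mul_le_mul_left h3 _
        _ = (1 + t) * ((1 - W') * g h₀) + d * g h₀ := by ring
        _ ≤ _ := by gcongr; exact mul_le_of_le_one_right' (hg1 _)

end Release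

/-! ### The weight as a function of the count -/

section Count

/-- The probability weight of a point that lies in `c` of `T` regions. -/
def countWeight (T : ℕ) (a η : ℝ) (c : ℕ) : ℝ := c / (2 * T) * min 1 (a * Real.exp (η * c))

variable {T : ℕ} {a η : ℝ}

theorem countWeight_nonneg (ha : 0 ≤ a) (c : ℕ) : 0 ≤ countWeight T a η c := by
  unfold countWeight; positivity

theorem countWeight_le (c : ℕ) : countWeight T a η c ≤ c / (2 * T) :=
  mul_le_of_le_one_right (by positivity) (min_le_left _ _)

theorem countWeight_mono (ha : 0 ≤ a) (hη : 0 ≤ η) : Monotone (countWeight T a η) := by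
  intro c c' h
  unfold countWeight
  have : (c : ℝ) ≤ c' := by exact_mod_cast h
  gcongr

/-- One factor e^η pays for the truncated exponential, the other for the linear factor: (c + 1)/c ≤
e^η once ηc ≥ 1. For smaller counts the truncated exponential is at most a·e, so the extra 1/(2T) in
the linear factor costs at most a·e²/2 ≤ 8a. -/
theorem countWeight_succ_le (hT : 0 < T) (ha : 0 ≤ a) (hη : 0 < η) (hη1 : η ≤ 1) (c : ℕ) :
    countWeight T a η (c + 1) ≤ Real.exp (2 * η) * countWeight T a η c + 8 * a := by
  have hT' : (1 : ℝ) ≤ T := by exact_mod_cast hT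
  set m : ℕ → ℝ := fun c => min 1 (a * Real.exp (η * c)) with hm
  have hm0 : ∀ c, 0 ≤ m c := fun c => by simp only [hm]; positivity
  have hms : m (c + 1) ≤ Real.exp η * m c := by
    simp only [hm]
    rw [mul_min_of_nonneg _ _ (Real.exp_pos η).le]
    refine min_le_min ?_ (le_of_eq ?_)
    · simpa using Real.one_le_exp hη.le
    · push_cast
      rw [mul_add, mul_one, Real.exp_add]; ring
  have hexp : η + 1 ≤ Real.exp η := Real.add_one_le_exp η
  have he2 : Real.exp (2 * η) = Real.exp η * Real.exp η := by rw [← Real.exp_add]; ring_nf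
  have h1 : countWeight T a η (c + 1) ≤ (c + 1) / (2 * T) * (Real.exp η * m c) := by
    unfold countWeight
    push_cast
    refine mul_le_mul_of_nonneg_left ?_ (by positivity)
    simpa [hm] using hms
  have h2 : countWeight T a η c = c / (2 * T) * m c := rfl
  rw [h2, he2]
  refine h1.trans ?_
  by_cases hc : 1 ≤ η * c
  · have h3 : (c : ℝ) + 1 ≤ c * Real.exp η := by nlinarith [(Nat.cast_nonneg c : (0 : ℝ) ≤ c)]
    calc _ ≤ (c * Real.exp η) / (2 * T) * (Real.exp η * m c) := by
          have := hm0 c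
          gcongr
      _ = Real.exp η * Real.exp η * (c / (2 * T) * m c) := by ring
      _ ≤ _ := by linarith
  · have h3 : m c ≤ a * Real.exp 1 := by
      refine (min_le_right _ _).trans ?_
      gcongr
      exact (not_le.1 hc).le
    have h4 : Real.exp η ≤ Real.exp 1 := Real.exp_le_exp.2 hη1
    have h5 : Real.exp 1 < 2.7182818286 := Real.exp_one_lt_d9
    have h6 : (1 : ℝ) / (2 * T) ≤ 1 / 2 := by
      gcongr
      linarith
    calc _ = c / (2 * T) * (1 * (Real.exp η * m c)) + 1 / (2 * T) * (Real.exp η * m c) := by ring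
      _ ≤ c / (2 * T) * (Real.exp η * (Real.exp η * m c)) +
          1 / 2 * (Real.exp 1 * (a * Real.exp 1)) := by
          have := hm0 c
          have := Real.one_le_exp hη.le
          gcongr
      _ ≤ _ := by
          have : Real.exp 1 * Real.exp 1 ≤ 16 := by nlinarith [Real.exp_pos 1]
          nlinarith

/-- From the count κT/4 on, the exponential is saturated and the minimum equals 1; only c/(2T)
remains. -/
theorem le_countWeight (hT : 0 < T) {κ : ℝ} (hη : 0 ≤ η) (ha : 0 < a) {c : ℕ}
    (hκ : 1 ≤ a * Real.exp (η * (κ * T / 4))) (hc : κ * T / 4 ≤ c) :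
    κ / 8 ≤ countWeight T a η c := by
  have hT' : (0 : ℝ) < T := by exact_mod_cast hT
  unfold countWeight
  rw [min_eq_left, mul_one, le_div_iff₀ (by positivity)]
  · linarith
  · refine hκ.trans ?_
    gcongr

end Count

/-- The integral of a product over i.i.d. coordinates is a power. -/
theorem lintegral_pi_prod_eq_pow {I : Type*} [MeasurableSpace I] (L : Measure I)
    [IsProbabilityMeasure L] {f : I → ℝ≥0∞} (hf : Measurable f) (n : ℕ) :
    ∫⁻ x : Fin n → I, ∏ i, f (x i) ∂(Measure.pi fun _ => L) = (∫⁻ x, f x ∂L) ^ n := by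
  induction n with
  | zero => simp
  | succ n ih =>
    have hm : Measurable fun x : Fin n → I => ∏ i, f (x i) :=
      Finset.measurable_prod _ fun i _ => hf.comp (measurable_pi_apply i)
    have h := (measurePreserving_piFinSuccAbove (fun _ : Fin (n + 1) => L) 0).lintegral_comp
      (f := fun z : I × (Fin n → I) => f z.1 * ∏ i, f (z.2 i))
      ((hf.comp measurable_fst).mul (hm.comp measurable_snd))
    rw [lintegral_prod_mul hf.aemeasurable hm.aemeasurable, ih, ← pow_succ'] at h
    rw [← h]
    refine lintegral_congr fun x => ?_
    rw [Fin.prod_univ_succ]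
    rfl

/-! ### The private mechanism on one batch of regions -/

section Block

variable {I Y Ω : Type*} [MeasurableSpace Y] [MeasurableSpace Ω]

open Classical in
/-- The number of indices `i ∈ F` whose region contains `y`. -/
def hits (R : I → Set Y) {T : ℕ} (F : Finset (Fin T)) (B : Fin T → I) (y : Y) : ℕ :=
  (F.filter fun i => y ∈ R (B i)).card

/-- The density of a point with respect to a batch of regions. -/
def batchWeight (R : I → Set Y) {T : ℕ} (a η : ℝ) (F : Finset (Fin T)) (B : Fin T → I) (y : Y) :
    ℝ≥0∞ :=
  ENNReal.ofReal (countWeight T a η (hits R F B y))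

variable {R : I → Set Y} {T : ℕ} {ν : Measure Y} {a η : ℝ}

omit [MeasurableSpace Y] in
theorem hits_eq_sum (F : Finset (Fin T)) (B : Fin T → I) (y : Y) :
    hits R F B y = ∑ i ∈ F, (R (B i)).indicator (fun _ => 1) y := by
  classical
  rw [hits, Finset.card_filter]
  refine Finset.sum_congr rfl fun i _ => ?_
  simp [indicator]

theorem measurable_hits (hR : ∀ i, MeasurableSet (R i)) (F : Finset (Fin T)) (B : Fin T → I) :
    Measurable (hits R F B) := by
  have : hits R F B = fun y => ∑ i ∈ F, (R (B i)).indicator (fun _ => 1) y :=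
    funext (hits_eq_sum F B)
  rw [this]
  exact Finset.measurable_sum _ fun i _ => measurable_const.indicator (hR _)

theorem measurable_batchWeight (hR : ∀ i, MeasurableSet (R i)) (F : Finset (Fin T))
    (B : Fin T → I) : Measurable (batchWeight R a η F B) :=
  (Measurable.of_discrete (f := fun c => ENNReal.ofReal (countWeight T a η c))).comp
    (measurable_hits hR F B)

/-- The envelope c/(2T) averages at most T indicators of sets of measure one. The factor 1/2
reserves the default mass that `dpLe_release` relies on. -/
theorem lintegral_batchWeight_le (hR : ∀ i, MeasurableSet (R i)) (hν : ∀ i, ν (R i) = 1)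
    (hT : 0 < T) (F : Finset (Fin T)) (B : Fin T → I) :
    ∫⁻ y, batchWeight R a η F B y ∂ν ≤ 2⁻¹ := by
  have hT' : (0 : ℝ) < T := by exact_mod_cast hT
  have h : ∀ y, batchWeight R a η F B y ≤
      ENNReal.ofReal (1 / (2 * T)) * ∑ i ∈ F, (R (B i)).indicator (fun _ => 1) y := by
    intro y
    have h1 : (∑ i ∈ F, (R (B i)).indicator (fun _ => (1 : ℝ≥0∞)) y) =
        ENNReal.ofReal (hits R F B y) := by
      rw [hits_eq_sum, ENNReal.ofReal_natCast]
      push_cast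
      refine Finset.sum_congr rfl fun i _ => ?_
      by_cases hy : y ∈ R (B i) <;> simp [hy]
    rw [h1, ← ENNReal.ofReal_mul (by positivity)]
    refine ENNReal.ofReal_le_ofReal ((countWeight_le _).trans (le_of_eq ?_))
    ring
  calc _ ≤ ∫⁻ y, ENNReal.ofReal (1 / (2 * T)) *
        ∑ i ∈ F, (R (B i)).indicator (fun _ => 1) y ∂ν := lintegral_mono h
    _ = ENNReal.ofReal (1 / (2 * T)) * ∑ i ∈ F, ν (R (B i)) := by
        rw [lintegral_const_mul _ (Finset.measurable_sum _ fun i _ =>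
          measurable_const.indicator (hR _)), lintegral_finsetSum _ fun i _ =>
          measurable_const.indicator (hR _)]
        congr 1
        exact Finset.sum_congr rfl fun i _ => lintegral_indicator_one (hR _)
    _ ≤ ENNReal.ofReal (1 / (2 * T)) * ENNReal.ofReal T := by
        gcongr
        simp only [hν, Finset.sum_const, nsmul_eq_mul, mul_one, ENNReal.ofReal_natCast]
        exact_mod_cast (Finset.card_le_univ F).trans (by simp)
    _ = 2⁻¹ := by
        rw [← ENNReal.ofReal_mul (by positivity)]
        have : 1 / (2 * (T : ℝ)) * T = 2⁻¹ := by field_simp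
        rw [this, ENNReal.ofReal_inv_of_pos (by norm_num)]
        norm_num

/-- Sample privately from a batch of probability measures, each given as a region. -/
def batchMechanism (R : I → Set Y) (ν : Measure Y) (π : Y → Ω) (h₀ : Ω) (a η : ℝ)
    {T : ℕ} (F : Finset (Fin T)) (B : Fin T → I) : Measure Ω :=
  release ν π h₀ (batchWeight R a η F B)

variable {π : Y → Ω} {h₀ : Ω}

theorem isProbabilityMeasure_batchMechanism (hR : ∀ i, MeasurableSet (R i))
    (hν : ∀ i, ν (R i) = 1) (hπ : Measurable π) (hT : 0 < T) (F : Finset (Fin T))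
    (B : Fin T → I) : IsProbabilityMeasure (batchMechanism R ν π h₀ a η F B) :=
  isProbabilityMeasure_release hπ (measurable_batchWeight hR F B)
    ((lintegral_batchWeight_le hR hν hT F B).trans (by norm_num))

/-- Deleting a region lowers the count by one, and only on that region. It has measure one, so the
pointwise additive error 8a integrates to at most 8a. -/
theorem dpLe_batchMechanism_erase (hR : ∀ i, MeasurableSet (R i)) (hν : ∀ i, ν (R i) = 1)
    (hπ : Measurable π) (hT : 0 < T) (ha : 0 ≤ a) (hη : 0 < η) (hη1 : η ≤ 1) (B : Fin T → I)
    (i : Fin T) :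
    DPLe (ENNReal.ofReal (Real.exp (2 * η))) (ENNReal.ofReal (8 * a))
      (batchMechanism R ν π h₀ a η Finset.univ B)
      (batchMechanism R ν π h₀ a η (Finset.univ.erase i) B) ∧
    DPLe (ENNReal.ofReal (Real.exp (2 * η))) (ENNReal.ofReal (8 * a))
      (batchMechanism R ν π h₀ a η (Finset.univ.erase i) B)
      (batchMechanism R ν π h₀ a η Finset.univ B) := by
  have hits_eq : ∀ y, hits R Finset.univ B y =
      hits R (Finset.univ.erase i) B y + (R (B i)).indicator (fun _ => 1) y := by
    intro y
    rw [hits_eq_sum, hits_eq_sum, Finset.sum_erase_add _ _ (Finset.mem_univ i)]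
  refine dpLe_release (R := R (B i)) hπ (measurable_batchWeight hR _ B)
    (measurable_batchWeight hR _ B) (hR _) (hν _).le ?_ ?_ ?_
    (lintegral_batchWeight_le hR hν hT _ B)
  · rw [ENNReal.one_le_ofReal]
    exact Real.one_le_exp (by positivity)
  · intro y
    refine ENNReal.ofReal_le_ofReal (countWeight_mono ha hη.le ?_)
    rw [hits_eq]
    exact Nat.le_add_right _ _
  · intro y
    simp only [batchWeight, hits_eq y]
    by_cases hy : y ∈ R (B i)
    · simp only [hy, indicator_of_mem]
      rw [← ENNReal.ofReal_mul (Real.exp_pos _).le, ← ENNReal.ofReal_add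
        (mul_nonneg (Real.exp_pos _).le (countWeight_nonneg ha _)) (by positivity)]
      exact ENNReal.ofReal_le_ofReal (countWeight_succ_le hT ha hη hη1 _)
    · simp only [hy, not_false_eq_true, indicator_of_notMem, add_zero]
      refine le_mul_of_one_le_left' ?_
      rw [ENNReal.one_le_ofReal]
      exact Real.one_le_exp (by positivity)

/-- Changing one region of the batch. -/
theorem dpLe_batchMechanism (hR : ∀ i, MeasurableSet (R i)) (hν : ∀ i, ν (R i) = 1)
    (hπ : Measurable π) (hT : 0 < T) (ha : 0 ≤ a) (hη : 0 < η) (hη1 : η ≤ 1 / 4)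
    {B B' : Fin T → I} (i : Fin T) (hB : ∀ j, j ≠ i → B j = B' j) :
    DPLe (ENNReal.ofReal (Real.exp (4 * η))) (ENNReal.ofReal (24 * a))
      (batchMechanism R ν π h₀ a η Finset.univ B)
      (batchMechanism R ν π h₀ a η Finset.univ B') := by
  have h1 := (dpLe_batchMechanism_erase (h₀ := h₀) hR hν hπ hT ha hη (by linarith) B i).1
  have h2 := (dpLe_batchMechanism_erase (h₀ := h₀) hR hν hπ hT ha hη (by linarith) B' i).2
  -- The two batches agree once region `i` is deleted, so the comparison passes through this common
  -- mechanism.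
  have h3 : batchMechanism R ν π h₀ a η (Finset.univ.erase i) B =
      batchMechanism R ν π h₀ a η (Finset.univ.erase i) B' := by
    unfold batchMechanism batchWeight
    congr 1
    funext y
    rw [hits_eq_sum, hits_eq_sum]
    congr 2
    refine Finset.sum_congr rfl fun j hj => ?_
    rw [hB j (Finset.ne_of_mem_erase hj)]
  rw [← h3] at h2
  refine (h1.trans h2).mono (le_of_eq ?_) ?_
  · rw [← ENNReal.ofReal_mul (Real.exp_pos _).le, ← Real.exp_add]
    ring_nf
  · rw [← ENNReal.ofReal_mul (Real.exp_pos _).le, ← ENNReal.ofReal_add (by positivity)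
      (by positivity)]
    refine ENNReal.ofReal_le_ofReal ?_
    -- The composed additive error is e^{2η}·8a + 8a, which is at most 24a.
    have h4 : Real.exp (2 * η) ≤ 2 := by
      have h5 : Real.exp (2 * η) * Real.exp (2 * η) ≤ 4 := by
        rw [← Real.exp_add]
        refine (Real.exp_le_exp.2 (by linarith : 2 * η + 2 * η ≤ 1)).trans ?_
        linarith [Real.exp_one_lt_d9]
      nlinarith [Real.exp_pos (2 * η)]
    nlinarith

variable [Countable I] [MeasurableSpace I] [MeasurableSingletonClass I]

-- Chernoff bound with exponent -1: each factor has mean at most 1 - κ/2 ≤ e^{-κ/2}, so the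
-- probability is at most e^{κT/4} e^{-κT/2} ≤ e^{-1} ≤ 1/2.
omit [MeasurableSpace Y] in
theorem measure_hits_lt_le (L : Measure I) [IsProbabilityMeasure L] {κ : ℝ} (hκT : 4 ≤ κ * T)
    {y : Y} (hy : ENNReal.ofReal κ ≤ L {i | y ∈ R i}) :
    (Measure.pi fun _ : Fin T => L) {B | (hits R Finset.univ B y : ℝ) < κ * T / 4} ≤ 2⁻¹ := by
  classical
  have he : Real.exp (-1) ≤ 1 / 2 := by
    rw [Real.exp_neg, one_div]
    exact inv_anti₀ (by norm_num) (by linarith [Real.exp_one_gt_d9])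
  set A : Set I := {i | y ∈ R i}
  have hA : MeasurableSet A := DiscreteMeasurableSpace.forall_measurableSet _
  set φ : I → ℝ≥0∞ := fun i => if y ∈ R i then ENNReal.ofReal (Real.exp (-1)) else 1
  have hφ : Measurable φ := Measurable.of_discrete
  have hprod : ∀ B : Fin T → I, ∏ i, φ (B i) =
      ENNReal.ofReal (Real.exp (-(hits R Finset.univ B y : ℝ))) := by
    intro B
    simp only [φ, hits]
    rw [Finset.prod_ite, Finset.prod_const_one, mul_one, Finset.prod_const,
      ← ENNReal.ofReal_pow (Real.exp_pos _).le, ← Real.exp_nat_mul]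
    simp
  have hφint : ∫⁻ i, φ i ∂L ≤ ENNReal.ofReal (Real.exp (-(κ / 2))) := by
    have h1 : ∫⁻ i, φ i ∂L + ENNReal.ofReal (1 / 2) * L A ≤ 1 := by
      rw [← lintegral_indicator_const hA, ← lintegral_add_left hφ]
      refine (lintegral_mono (g := fun _ => 1) fun i => ?_).trans (by simp)
      by_cases hi : y ∈ R i
      · have : i ∈ A := hi
        simp only [φ, hi, this, if_true, indicator_of_mem]
        rw [← ENNReal.ofReal_add (Real.exp_pos _).le (by norm_num), ← ENNReal.ofReal_one]
        exact ENNReal.ofReal_le_ofReal (by linarith)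
      · have : i ∉ A := hi
        simp [φ, hi, this]
    have h2 : ∫⁻ i, φ i ∂L + ENNReal.ofReal (κ / 2) ≤ 1 := by
      refine le_trans ?_ h1
      gcongr
      rw [div_eq_mul_one_div, mul_comm, ENNReal.ofReal_mul (by norm_num)]
      gcongr
    calc _ ≤ 1 - ENNReal.ofReal (κ / 2) := ENNReal.le_sub_of_add_le_right (by simp) h2
      _ = ENNReal.ofReal (1 - κ / 2) := by
          rw [ENNReal.ofReal_sub _ (by nlinarith [(Nat.cast_nonneg T : (0 : ℝ) ≤ T)])]
          simp
      _ ≤ _ := ENNReal.ofReal_le_ofReal (by linarith [Real.add_one_le_exp (-(κ / 2))])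
  have hset : MeasurableSet {B : Fin T → I | (hits R Finset.univ B y : ℝ) < κ * T / 4} :=
    DiscreteMeasurableSpace.forall_measurableSet _
  calc _ = ∫⁻ B, {B : Fin T → I | (hits R Finset.univ B y : ℝ) < κ * T / 4}.indicator 1 B
        ∂(Measure.pi fun _ : Fin T => L) := (lintegral_indicator_one hset).symm
    _ ≤ ∫⁻ B : Fin T → I, ENNReal.ofReal (Real.exp (κ * T / 4)) * ∏ i, φ (B i)
        ∂(Measure.pi fun _ : Fin T => L) := by
        refine lintegral_mono (Set.indicator_le fun B hB => ?_)
        rw [hprod, ← ENNReal.ofReal_mul (Real.exp_pos _).le, ← Real.exp_add]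
        have hB' : (hits R Finset.univ B y : ℝ) < κ * T / 4 := hB
        rw [Pi.one_apply, ENNReal.one_le_ofReal]
        exact Real.one_le_exp (by linarith)
    _ = ENNReal.ofReal (Real.exp (κ * T / 4)) * (∫⁻ i, φ i ∂L) ^ T := by
        rw [lintegral_const_mul _ Measurable.of_discrete, lintegral_pi_prod_eq_pow L hφ]
    _ ≤ ENNReal.ofReal (Real.exp (κ * T / 4)) * ENNReal.ofReal (Real.exp (-(κ / 2))) ^ T := by
        gcongr
    _ = ENNReal.ofReal (Real.exp (-(κ * T / 4))) := by
        rw [← ENNReal.ofReal_pow (Real.exp_pos _).le, ← Real.exp_nat_mul,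
          ← ENNReal.ofReal_mul (Real.exp_pos _).le, ← Real.exp_add]
        ring_nf
    _ ≤ ENNReal.ofReal (1 / 2) :=
        ENNReal.ofReal_le_ofReal ((Real.exp_le_exp.2 (by linarith)).trans he)
    _ = 2⁻¹ := by rw [one_div, ENNReal.ofReal_inv_of_pos (by norm_num)]; norm_num

omit [MeasurableSpace Y] in
theorem le_lintegral_batchWeight (L : Measure I) [IsProbabilityMeasure L] {κ : ℝ} (hκ : 0 ≤ κ)
    (hT : 0 < T) (hκT : 4 ≤ κ * T) (ha : 0 < a) (hη : 0 ≤ η)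
    (hexp : 1 ≤ a * Real.exp (η * (κ * T / 4))) {y : Y}
    (hy : ENNReal.ofReal κ ≤ L {i | y ∈ R i}) :
    ENNReal.ofReal (κ / 16) ≤
      ∫⁻ B, batchWeight R a η Finset.univ B y ∂(Measure.pi fun _ : Fin T => L) := by
  set U : Set (Fin T → I) := {B | (hits R Finset.univ B y : ℝ) < κ * T / 4}
  have hU : MeasurableSet U := DiscreteMeasurableSpace.forall_measurableSet _
  have h1 : 2⁻¹ ≤ (Measure.pi fun _ : Fin T => L) Uᶜ := by
    rw [prob_compl_eq_one_sub hU, ← ENNReal.one_sub_inv_two]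
    exact tsub_le_tsub_left (measure_hits_lt_le L hκT hy) 1
  calc ENNReal.ofReal (κ / 16) = ENNReal.ofReal (κ / 8) * 2⁻¹ := by
        have : κ / 16 = κ / 8 * 2⁻¹ := by ring
        rw [this, ENNReal.ofReal_mul (by positivity), ENNReal.ofReal_inv_of_pos (by norm_num)]
        norm_num
    _ ≤ ENNReal.ofReal (κ / 8) * (Measure.pi fun _ : Fin T => L) Uᶜ := by gcongr
    _ = ∫⁻ B, Uᶜ.indicator (fun _ => ENNReal.ofReal (κ / 8)) B
        ∂(Measure.pi fun _ : Fin T => L) := (lintegral_indicator_const hU.compl _).symm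
    _ ≤ _ := by
        refine lintegral_mono (Set.indicator_le fun B hB => ?_)
        exact ENNReal.ofReal_le_ofReal (le_countWeight hT hη ha hexp (not_lt.1 fun h => hB h))

/-- The mechanism succeeds with a probability bounded below in terms of the measure of the
heavily covered points over `G`. -/
theorem le_lintegral_batchMechanism [SFinite ν] (hR : ∀ i, MeasurableSet (R i))
    (hπ : Measurable π) (L : Measure I) [IsProbabilityMeasure L]
    (hcov : Measurable fun y => L {i | y ∈ R i}) {κ : ℝ}
    (hκ : 0 ≤ κ) (hT : 0 < T) (hκT : 4 ≤ κ * T) (ha : 0 < a) (hη : 0 ≤ η)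
    (hexp : 1 ≤ a * Real.exp (η * (κ * T / 4))) {G : Set Ω} (hG : MeasurableSet G) :
    ENNReal.ofReal (κ / 16) * ν ({y | ENNReal.ofReal κ ≤ L {i | y ∈ R i}} ∩ π ⁻¹' G) ≤
      ∫⁻ B, batchMechanism R ν π h₀ a η Finset.univ B G ∂(Measure.pi fun _ : Fin T => L) := by
  set F : Set Y := {y | ENNReal.ofReal κ ≤ L {i | y ∈ R i}} ∩ π ⁻¹' G
  have hF : MeasurableSet F := (measurableSet_le measurable_const hcov).inter (hπ hG)
  calc _ = ∫⁻ _ in F, ENNReal.ofReal (κ / 16) ∂ν := (setLIntegral_const _ _).symm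
    _ ≤ ∫⁻ y in F, ∫⁻ B, batchWeight R a η Finset.univ B y ∂(Measure.pi fun _ : Fin T => L) ∂ν :=
        setLIntegral_mono' hF fun y hy => le_lintegral_batchWeight L hκ hT hκT ha hη hexp hy.1
    _ ≤ ∫⁻ y in π ⁻¹' G,
          ∫⁻ B, batchWeight R a η Finset.univ B y ∂(Measure.pi fun _ : Fin T => L) ∂ν :=
        lintegral_mono_set inter_subset_right
    _ = ∫⁻ B, ∫⁻ y in π ⁻¹' G, batchWeight R a η Finset.univ B y ∂ν
          ∂(Measure.pi fun _ : Fin T => L) := by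
        refine lintegral_lintegral_swap (measurable_from_prod_countable_left fun B => ?_).aemeasurable
        exact measurable_batchWeight hR _ B
    _ ≤ _ := lintegral_mono fun B => le_release hπ hG

end Block

/-! ### The exponential mechanism on a validation sample -/

section Select

variable {X : Type*}

open Classical in
/-- The zero-one loss of a classifier on an example. -/
def loss (h : X → Bool) (z : X × Bool) : ℝ := if h z.1 ≠ z.2 then 1 else 0

/-- The exponential weight of a classifier on a validation sample. -/
def selectWeight (l : ℝ) {M : ℕ} (V : Sample X M) (h : X → Bool) : ℝ :=
  Real.exp (-l * ∑ i, loss h (V i))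

/-- The exponential mechanism: choose one of the classifiers `hs j` on a validation sample. -/
def select (l : ℝ) {M k : ℕ} (V : Sample X M) (hs : Fin (k + 1) → X → Bool) :
    Measure (X → Bool) :=
  Measure.sum fun j => ENNReal.ofReal (selectWeight l V (hs j) / ∑ i, selectWeight l V (hs i)) •
    Measure.dirac (hs j)

variable {l : ℝ} {M k : ℕ}

theorem loss_mem_Icc (h : X → Bool) (z : X × Bool) : loss h z ∈ Icc (0 : ℝ) 1 := by
  unfold loss
  split_ifs <;> simp

theorem selectWeight_pos (V : Sample X M) (h : X → Bool) : 0 < selectWeight l V h :=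
  Real.exp_pos _

theorem sum_selectWeight_pos (V : Sample X M) (hs : Fin (k + 1) → X → Bool) :
    0 < ∑ i, selectWeight l V (hs i) :=
  Finset.sum_pos (fun _ _ => selectWeight_pos V _) Finset.univ_nonempty

theorem measurableSet_setOf_ne (z : X × Bool) : MeasurableSet {h : X → Bool | h z.1 ≠ z.2} := by
  have : Measurable fun h : X → Bool => h z.1 := measurable_pi_apply _
  exact (this (measurableSet_singleton z.2)).compl

theorem measurable_loss (z : X × Bool) : Measurable fun h : X → Bool => loss h z := by
  unfold loss
  exact Measurable.ite (measurableSet_setOf_ne z) measurable_const measurable_const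

theorem measurable_selectWeight (V : Sample X M) : Measurable (selectWeight l V) :=
  Real.measurable_exp.comp ((Finset.measurable_sum _ fun i _ => measurable_loss (V i)).const_mul _)

theorem select_apply (V : Sample X M) (hs : Fin (k + 1) → X → Bool) {E : Set (X → Bool)}
    (hE : MeasurableSet E) : select l V hs E =
      ∑ j, ENNReal.ofReal (selectWeight l V (hs j) / ∑ i, selectWeight l V (hs i)) *
        E.indicator 1 (hs j) := by
  rw [select, Measure.sum_apply _ hE, tsum_fintype]
  simp [Measure.dirac_apply' _ hE]

theorem isProbabilityMeasure_select (V : Sample X M) (hs : Fin (k + 1) → X → Bool) :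
    IsProbabilityMeasure (select l V hs) := by
  have hpos := sum_selectWeight_pos (l := l) V hs
  constructor
  rw [select_apply V hs MeasurableSet.univ]
  simp only [indicator_univ, Pi.one_apply, mul_one]
  rw [← ENNReal.ofReal_sum_of_nonneg fun j _ => div_nonneg (selectWeight_pos V _).le hpos.le,
    ← Finset.sum_div, div_self hpos.ne', ENNReal.ofReal_one]

theorem measurable_select (V : Sample X M) :
    Measurable fun hs : Fin (k + 1) → X → Bool => select l V hs := by
  refine Measure.measurable_of_measurable_coe _ fun E hE => ?_
  simp_rw [select_apply V _ hE]
  have hw : ∀ j, Measurable fun hs : Fin (k + 1) → X → Bool => selectWeight l V (hs j) :=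
    fun j => (measurable_selectWeight V).comp (measurable_pi_apply j)
  refine Finset.measurable_sum _ fun j _ => Measurable.mul ?_ ?_
  · exact ((hw j).div (Finset.measurable_sum _ fun i _ => hw i)).ennreal_ofReal
  · exact (measurable_one.indicator hE).comp (measurable_pi_apply j)

theorem selectWeight_le (hl : 0 ≤ l) {V V' : Sample X M} (i : Fin M)
    (hV : ∀ j, j ≠ i → V j = V' j) (h : X → Bool) :
    selectWeight l V h ≤ Real.exp l * selectWeight l V' h := by
  unfold selectWeight
  rw [← Real.exp_add, Real.exp_le_exp]
  have h1 : ∑ j ∈ Finset.univ.erase i, loss h (V j) = ∑ j ∈ Finset.univ.erase i, loss h (V' j) :=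
    Finset.sum_congr rfl fun j hj => by rw [hV j (Finset.ne_of_mem_erase hj)]
  rw [← Finset.add_sum_erase _ _ (Finset.mem_univ i), h1,
    ← Finset.add_sum_erase _ (fun j => loss h (V' j)) (Finset.mem_univ i)]
  nlinarith [(loss_mem_Icc h (V i)).1, (loss_mem_Icc h (V' i)).2]

/-- One factor e^l comes from the weight in the numerator and one from the normalizing sum. -/
theorem select_le (hl : 0 ≤ l) {V V' : Sample X M} (i : Fin M) (hV : ∀ j, j ≠ i → V j = V' j)
    (hs : Fin (k + 1) → X → Bool) {E : Set (X → Bool)} (hE : MeasurableSet E) :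
    select l V hs E ≤ ENNReal.ofReal (Real.exp (2 * l)) * select l V' hs E := by
  rw [select_apply V hs hE, select_apply V' hs hE, Finset.mul_sum]
  refine Finset.sum_le_sum fun j _ => ?_
  rw [← mul_assoc, ← ENNReal.ofReal_mul (Real.exp_pos _).le]
  refine mul_le_mul_left (ENNReal.ofReal_le_ofReal ?_) _
  have h1 := selectWeight_le hl i hV (hs j)
  have h2 : ∑ m, selectWeight l V' (hs m) ≤ Real.exp l * ∑ m, selectWeight l V (hs m) := by
    rw [Finset.mul_sum]
    exact Finset.sum_le_sum fun m _ => selectWeight_le hl i (fun j hj => (hV j hj).symm) _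
  have hp := sum_selectWeight_pos (l := l) V hs
  have hp' := sum_selectWeight_pos (l := l) V' hs
  rw [← mul_div_assoc, div_le_div_iff₀ hp hp']
  have he : Real.exp (2 * l) = Real.exp l * Real.exp l := by rw [← Real.exp_add]; ring_nf
  calc _ ≤ (Real.exp l * selectWeight l V' (hs j)) *
        (Real.exp l * ∑ m, selectWeight l V (hs m)) :=
        mul_le_mul h1 h2 hp'.le (mul_pos (Real.exp_pos _) (selectWeight_pos V' _)).le
    _ = _ := by rw [he]; ring

variable [Countable X] [MeasurableSpace X] [MeasurableSingletonClass X]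

theorem integral_loss (D : Measure (X × Bool)) (h : X → Bool) : ∫ z, loss h z ∂D = err D h := by
  have : loss h = {z : X × Bool | h z.1 ≠ z.2}.indicator 1 := by
    funext z
    simp [loss, indicator]
  rw [this, integral_indicator_one (DiscreteMeasurableSpace.forall_measurableSet _), err]

/-- Using e^x ≤ 1 + x + x² for |x| ≤ 1, the mean is at most 1 - lγ + l², and l ≤ γ/2 absorbs the
quadratic term into half of the linear one. -/
theorem lintegral_exp_loss_le (D : Measure (X × Bool)) [IsProbabilityMeasure D] {γ : ℝ}
    (hl : 0 ≤ l) (hlγ : l ≤ γ / 2) (hl1 : l ≤ 1) {h g : X → Bool} (hhg : err D g + γ ≤ err D h) :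
    ∫⁻ z, ENNReal.ofReal (Real.exp (-l * (loss h z - loss g z))) ∂D ≤
      ENNReal.ofReal (Real.exp (-(l * γ / 2))) := by
  have hint : ∀ f : X → Bool, Integrable (loss f) D := fun f => by
    refine Integrable.of_bound (C := 1) Measurable.of_discrete.aestronglyMeasurable
      (.of_forall fun z => ?_)
    rw [Real.norm_eq_abs, abs_of_nonneg (loss_mem_Icc f z).1]
    exact (loss_mem_Icc f z).2
  have hpt : ∀ z, Real.exp (-l * (loss h z - loss g z)) ≤
      1 - l * (loss h z - loss g z) + l ^ 2 := by
    intro z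
    obtain ⟨h1, h2⟩ := loss_mem_Icc h z
    obtain ⟨h3, h4⟩ := loss_mem_Icc g z
    have h5 : |loss h z - loss g z| ≤ 1 := abs_le.2 ⟨by linarith, by linarith⟩
    have h6 : |-l * (loss h z - loss g z)| ≤ l := by
      rw [abs_mul, abs_neg, abs_of_nonneg hl]
      exact mul_le_of_le_one_right hl h5
    have h7 := (abs_le.1 (Real.abs_exp_sub_one_sub_id_le (h6.trans hl1))).2
    have h8 : (-l * (loss h z - loss g z)) ^ 2 ≤ l ^ 2 := by
      rw [← sq_abs]
      exact pow_le_pow_left₀ (abs_nonneg _) h6 2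
    linarith
  have hI : Integrable (fun z => 1 - l * (loss h z - loss g z) + l ^ 2) D :=
    ((integrable_const _).sub (((hint h).sub (hint g)).const_mul l)).add (integrable_const _)
  calc _ ≤ ∫⁻ z, ENNReal.ofReal (1 - l * (loss h z - loss g z) + l ^ 2) ∂D :=
        lintegral_mono fun z => ENNReal.ofReal_le_ofReal (hpt z)
    _ = ENNReal.ofReal (∫ z, (1 - l * (loss h z - loss g z) + l ^ 2) ∂D) :=
        (ofReal_integral_eq_lintegral_ofReal hI
          (.of_forall fun z => (Real.exp_pos _).le.trans (hpt z))).symm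
    _ = ENNReal.ofReal (1 - l * (err D h - err D g) + l ^ 2) := by
        congr 1
        have hd : Integrable (fun z => l * (loss h z - loss g z)) D :=
          ((hint h).sub (hint g)).const_mul l
        have hd' : Integrable (fun z => 1 - l * (loss h z - loss g z)) D :=
          (integrable_const _).sub hd
        rw [integral_add hd' (integrable_const _), integral_sub (integrable_const _) hd,
          integral_const_mul, integral_sub (hint h) (hint g), integral_loss, integral_loss]
        simp
    _ ≤ _ := by
        refine ENNReal.ofReal_le_ofReal ?_
        have := Real.add_one_le_exp (-(l * γ / 2))
        nlinarith

/-- A bad candidate is selected with probability at most the ratio of its weight to that of one good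
candidate. This ratio is a product over i.i.d. examples, so its mean is an M-th power. Concentration
of empirical errors and utility of the mechanism are thereby handled at once, without uniform
convergence. -/
theorem lintegral_select_le (D : Measure (X × Bool)) [IsProbabilityMeasure D] {α γ : ℝ}
    (hl : 0 ≤ l) (hlγ : l ≤ γ / 2) (hl1 : l ≤ 1) {hs : Fin (k + 1) → X → Bool}
    (hgood : ∃ j, err D (hs j) ≤ α) (hbad : MeasurableSet {h : X → Bool | α + γ < err D h}) :
    ∫⁻ V : Sample X M, select l V hs {h | α + γ < err D h} ∂(sampleLaw D M) ≤
      (k + 1) * ENNReal.ofReal (Real.exp (-(l * γ / 2))) ^ M := by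
  obtain ⟨g, hg⟩ := hgood
  simp_rw [select_apply _ hs hbad]
  rw [lintegral_finsetSum _ fun _ _ => Measurable.of_discrete]
  have hterm : ∀ j, ∫⁻ V : Sample X M,
      ENNReal.ofReal (selectWeight l V (hs j) / ∑ i, selectWeight l V (hs i)) *
        {h | α + γ < err D h}.indicator 1 (hs j) ∂(sampleLaw D M) ≤
      ENNReal.ofReal (Real.exp (-(l * γ / 2))) ^ M := by
    intro j
    by_cases hj : α + γ < err D (hs j)
    · calc _ ≤ ∫⁻ V : Sample X M,
            ∏ i, ENNReal.ofReal (Real.exp (-l * (loss (hs j) (V i) - loss (hs g) (V i))))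
              ∂(sampleLaw D M) := by
            refine lintegral_mono fun V => ?_
            have hj' : hs j ∈ {h | α + γ < err D h} := hj
            rw [indicator_of_mem hj', Pi.one_apply, mul_one,
              ← ENNReal.ofReal_prod_of_nonneg fun _ _ => (Real.exp_pos _).le]
            refine ENNReal.ofReal_le_ofReal ?_
            rw [← Real.exp_sum, ← Finset.mul_sum, Finset.sum_sub_distrib, mul_sub, Real.exp_sub]
            refine div_le_div_of_nonneg_left (Real.exp_pos _).le (Real.exp_pos _) ?_
            exact Finset.single_le_sum (f := fun i => selectWeight l V (hs i))
              (fun i _ => (selectWeight_pos V _).le) (Finset.mem_univ g)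
        _ = (∫⁻ z, ENNReal.ofReal (Real.exp (-l * (loss (hs j) z - loss (hs g) z))) ∂D) ^ M :=
            lintegral_pi_prod_eq_pow D (f := fun z =>
              ENNReal.ofReal (Real.exp (-l * (loss (hs j) z - loss (hs g) z))))
              Measurable.of_discrete M
        _ ≤ _ := by
            gcongr
            exact lintegral_exp_loss_le D hl hlγ hl1 (by linarith)
    · have : hs j ∉ {h | α + γ < err D h} := hj
      simp [this]
  refine (Finset.sum_le_sum fun j _ => hterm j).trans (le_of_eq ?_)
  simp

theorem measurable_err (D : Measure (X × Bool)) [IsProbabilityMeasure D] :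
    Measurable (err D) := by
  have h : MeasurableSet {p : (X → Bool) × (X × Bool) | p.1 p.2.1 ≠ p.2.2} := by
    have : {p : (X → Bool) × (X × Bool) | p.1 p.2.1 ≠ p.2.2} =
        ⋃ z : X × Bool, {h : X → Bool | h z.1 ≠ z.2} ×ˢ {z} := by
      ext ⟨h, z⟩
      simp
    rw [this]
    exact .iUnion fun z => (measurableSet_setOf_ne z).prod (measurableSet_singleton z)
  exact (measurable_measure_prodMk_left h).ennreal_toReal

end Select

/-! ### Splitting a sample into training batches and a validation part -/

section Blocks

variable {X : Type*} {k T n M m : ℕ}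

/-- The training batches of a sample whose indices are split along `e`. -/
def trainPart (e : (Fin (k + 1) × Fin T × Fin n) ⊕ Fin M ≃ Fin m) (S : Sample X m) :
    Fin (k + 1) → Fin T → Sample X n := fun j t i => S (e (.inl (j, t, i)))

/-- The validation part of a sample whose indices are split along `e`. -/
def validPart (e : (Fin (k + 1) × Fin T × Fin n) ⊕ Fin M ≃ Fin m) (S : Sample X m) :
    Sample X M := fun i => S (e (.inr i))

theorem trainPart_validPart_injective (e : (Fin (k + 1) × Fin T × Fin n) ⊕ Fin M ≃ Fin m) :
    Function.Injective fun S : Sample X m => (trainPart e S, validPart e S) := by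
  intro S S' h
  obtain ⟨h1, h2⟩ := Prod.mk.inj h
  funext i
  obtain ⟨s, rfl⟩ := e.surjective i
  rcases s with ⟨j, t, i⟩ | i
  · exact congrFun (congrFun (congrFun h1 j) t) i
  · exact congrFun h2 i

theorem trainPart_validPart_surjective (e : (Fin (k + 1) × Fin T × Fin n) ⊕ Fin M ≃ Fin m) :
    Function.Surjective fun S : Sample X m => (trainPart e S, validPart e S) := by
  rintro ⟨B, V⟩
  refine ⟨fun i => Sum.elim (fun s => B s.1 s.2.1 s.2.2) V (e.symm i), ?_⟩
  refine Prod.ext ?_ ?_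
  · funext j t i
    simp [trainPart]
  · funext i
    simp [validPart]

variable [Countable X] [MeasurableSpace X] [MeasurableSingletonClass X]

instance (D : Measure (X × Bool)) [IsProbabilityMeasure D] :
    IsProbabilityMeasure (sampleLaw D n) := by unfold sampleLaw; infer_instance

/-- Both measures live on a countable discrete space, and at each point their masses are the same
product of example masses, reindexed along `e`. -/
theorem map_sampleLaw (e : (Fin (k + 1) × Fin T × Fin n) ⊕ Fin M ≃ Fin m)
    (D : Measure (X × Bool)) [IsProbabilityMeasure D] :
    (sampleLaw D m).map (fun S => (trainPart e S, validPart e S)) =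
      (Measure.pi fun _ : Fin (k + 1) => Measure.pi fun _ : Fin T => sampleLaw D n).prod
        (sampleLaw D M) := by
  refine Measure.ext_of_singleton fun p => ?_
  obtain ⟨S, rfl⟩ := trainPart_validPart_surjective e p
  rw [Measure.map_apply Measurable.of_discrete (measurableSet_singleton _)]
  have h1 : (fun S : Sample X m => (trainPart e S, validPart e S)) ⁻¹'
      {(trainPart e S, validPart e S)} = {S} := by
    ext S'
    simp only [mem_preimage, mem_singleton_iff]
    exact (trainPart_validPart_injective e).eq_iff
  rw [h1, ← singleton_prod_singleton, Measure.prod_prod]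
  simp only [sampleLaw, Measure.pi_singleton]
  rw [← Fintype.prod_equiv e (fun s => D {S (e s)}) (fun i => D {S i}) fun _ => rfl,
    Fintype.prod_sum_type, Fintype.prod_prod_type]
  simp only [Fintype.prod_prod_type]
  rfl

end Blocks

/-! ### The private learner: privacy and accuracy -/

section Private

variable {X : Type*} [Countable X] [MeasurableSpace X]
  {n : ℕ} (A : LearningRule X n) (a η l : ℝ) {k T M : ℕ}

/-- Sample privately from the posteriors on one batch of samples. -/
def batchRule (B : Fin T → Sample X n) : Measure (X → Bool) :=
  batchMechanism (hypograph A.posterior) (baseMeasure A.posterior) Prod.fst (fun _ => false) a η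
    Finset.univ B

/-- Sample privately from each batch and select one of the results on the validation sample. -/
def privateRule (B : Fin (k + 1) → Fin T → Sample X n) (V : Sample X M) : Measure (X → Bool) :=
  (Measure.pi fun j => batchRule A a η (B j)).bind (select l V)

theorem isProbabilityMeasure_batchRule (hT : 0 < T) (B : Fin T → Sample X n) :
    IsProbabilityMeasure (batchRule A a η B) :=
  isProbabilityMeasure_batchMechanism (measurableSet_hypograph _) (baseMeasure_hypograph _)
    measurable_fst hT _ B

theorem privateRule_apply (B : Fin (k + 1) → Fin T → Sample X n) (V : Sample X M)
    {E : Set (X → Bool)} (hE : MeasurableSet E) : privateRule A a η l B V E =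
      ∫⁻ hs, select l V hs E ∂(Measure.pi fun j => batchRule A a η (B j)) :=
  Measure.bind_apply hE (measurable_select V).aemeasurable

theorem isProbabilityMeasure_privateRule (hT : 0 < T) (B : Fin (k + 1) → Fin T → Sample X n)
    (V : Sample X M) : IsProbabilityMeasure (privateRule A a η l B V) := by
  have := isProbabilityMeasure_batchRule A a η hT
  have := isProbabilityMeasure_select (k := k) (l := l) V
  constructor
  rw [privateRule_apply _ _ _ _ _ _ MeasurableSet.univ]
  simp

/-- Only factor `j` of the product of batch outputs changes. Selection is post-processing: the
probability that it lands in `E` is a [0, 1]-valued test function, which is why `DPLe` is tested on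
functions. -/
theorem privateRule_train_le (hT : 0 < T) (ha : 0 ≤ a) (hη : 0 < η) (hη1 : η ≤ 1 / 4)
    {B B' : Fin (k + 1) → Fin T → Sample X n} (j : Fin (k + 1)) (t : Fin T)
    (hj : ∀ j', j' ≠ j → B j' = B' j') (ht : ∀ t', t' ≠ t → B j t' = B' j t') (V : Sample X M)
    {E : Set (X → Bool)} (hE : MeasurableSet E) :
    privateRule A a η l B V E ≤ ENNReal.ofReal (Real.exp (4 * η)) * privateRule A a η l B' V E +
      ENNReal.ofReal (24 * a) := by
  have := isProbabilityMeasure_batchRule A a η hT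
  rw [privateRule_apply _ _ _ _ _ _ hE, privateRule_apply _ _ _ _ _ _ hE]
  have h : DPLe (ENNReal.ofReal (Real.exp (4 * η))) (ENNReal.ofReal (24 * a))
      (Measure.pi fun j => batchRule A a η (B j)) (Measure.pi fun j => batchRule A a η (B' j)) := by
    refine DPLe.pi j ?_ fun j' hj' => by rw [hj j' hj']
    exact dpLe_batchMechanism (measurableSet_hypograph _) (baseMeasure_hypograph _)
      measurable_fst hT ha hη hη1 t ht
  refine h _ ((Measure.measurable_coe hE).comp (measurable_select V)) fun hs => ?_
  have := isProbabilityMeasure_select (l := l) V hs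
  exact prob_le_one

theorem privateRule_valid_le (hl : 0 ≤ l) (B : Fin (k + 1) → Fin T → Sample X n)
    {V V' : Sample X M} (i : Fin M) (hV : ∀ j, j ≠ i → V j = V' j)
    {E : Set (X → Bool)} (hE : MeasurableSet E) :
    privateRule A a η l B V E ≤
      ENNReal.ofReal (Real.exp (2 * l)) * privateRule A a η l B V' E := by
  have hm : Measurable fun hs : Fin (k + 1) → X → Bool => select l V' hs E :=
    (Measure.measurable_coe hE).comp (measurable_select V')
  rw [privateRule_apply _ _ _ _ _ _ hE, privateRule_apply _ _ _ _ _ _ hE,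
    ← lintegral_const_mul _ hm]
  exact lintegral_mono fun hs => select_le hl i hV hs hE

variable [MeasurableSingletonClass X]

/-- The mechanism `privateRule` as a learning rule. -/
def privateLearner (hT : 0 < T) {m : ℕ} (e : (Fin (k + 1) × Fin T × Fin n) ⊕ Fin M ≃ Fin m) :
    LearningRule X m where
  posterior := ⟨fun S => privateRule A a η l (trainPart e S) (validPart e S),
    Measurable.of_discrete⟩
  isMarkov := ⟨fun _ => isProbabilityMeasure_privateRule A a η l hT _ _⟩

theorem privateLearner_apply (hT : 0 < T) {m : ℕ}
    (e : (Fin (k + 1) × Fin T × Fin n) ⊕ Fin M ≃ Fin m) (S : Sample X m) :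
    (privateLearner A a η l hT e).posterior S =
      privateRule A a η l (trainPart e S) (validPart e S) := rfl

/-- The parameters a = δ/24 and η = ε/4 turn the batch guarantee (4η, 24a) into (ε, δ); a change in
the validation part costs only 2l ≤ ε. -/
theorem differentiallyPrivate_privateLearner (hT : 0 < T) {m : ℕ}
    (e : (Fin (k + 1) × Fin T × Fin n) ⊕ Fin M ≃ Fin m) {ε δ : ℝ} (hε : ε ∈ Ioo (0 : ℝ) 1)
    (hδ : 0 < δ) (hl : 0 ≤ l) (hlε : 2 * l ≤ ε) :
    DifferentiallyPrivate (privateLearner A (δ / 24) (ε / 4) l hT e) ε δ := by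
  have key : ∀ S S' : Sample X m, (∃ i, ∀ j, j ≠ i → S j = S' j) → ∀ E, MeasurableSet E →
      ((privateLearner A (δ / 24) (ε / 4) l hT e).posterior S).real E ≤
      Real.exp ε * ((privateLearner A (δ / 24) (ε / 4) l hT e).posterior S').real E + δ := by
    rintro S S' ⟨i, hi⟩ E hE
    have h : (privateLearner A (δ / 24) (ε / 4) l hT e).posterior S E ≤
        ENNReal.ofReal (Real.exp ε) *
          (privateLearner A (δ / 24) (ε / 4) l hT e).posterior S' E + ENNReal.ofReal δ := by
      rw [privateLearner_apply, privateLearner_apply]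
      obtain ⟨s, rfl⟩ := e.surjective i
      rcases s with ⟨j, t, i⟩ | i
      · have hV : validPart e S = validPart e S' := by
          funext i'
          exact hi _ (by simp)
        rw [hV]
        have h := privateRule_train_le A (δ / 24) (ε / 4) l hT (by positivity)
          (by linarith [hε.1]) (by linarith [hε.2]) (B := trainPart e S) (B' := trainPart e S') j t
          (fun j' hj' => by
            funext t' i'
            exact hi _ (by simp [hj']))
          (fun t' ht' => by
            funext i'
            exact hi _ (by simp [ht'])) (validPart e S') hE
        have h1 : 4 * (ε / 4) = ε := by ring
        have h2 : 24 * (δ / 24) = δ := by ring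
        rwa [h1, h2] at h
      · have hB : trainPart e S = trainPart e S' := by
          funext j' t' i'
          exact hi _ (by simp)
        rw [hB]
        refine (privateRule_valid_le A (δ / 24) (ε / 4) l hl (trainPart e S') i
          (fun i' hi' => hi _ (by simp [hi'])) hE).trans (le_trans ?_ le_self_add)
        exact mul_le_mul_left (ENNReal.ofReal_le_ofReal (Real.exp_le_exp.2 hlε)) _
    rw [← ofReal_measureReal, ← ofReal_measureReal,
      ← ENNReal.ofReal_mul (Real.exp_pos _).le, ← ENNReal.ofReal_add (by positivity) hδ.le] at h
    exact (ENNReal.ofReal_le_ofReal_iff (by positivity)).1 h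
  rintro S S' ⟨i, hi⟩ E hE
  exact ⟨key S S' ⟨i, hi⟩ E hE, key S' S ⟨i, fun j hj => (hi j hj).symm⟩ E hE⟩

variable {A} {a η l}

/-- One batch produces an accurate classifier with a constant probability. -/
theorem le_lintegral_batchRule (D : Measure (X × Bool)) [IsProbabilityMeasure D] {ρ α β κ : ℝ}
    (hκ : 0 ≤ κ) (hβ : 0 ≤ β) (hκβ : 2 * κ + β = 1 - ρ) (htv : TVIndistinguishable A ρ D)
    (hacc : Accurate A α β D) (hT : 0 < T) (hκT : 4 ≤ κ * T) (ha : 0 < a) (hη : 0 ≤ η)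
    (hexp : 1 ≤ a * Real.exp (η * (κ * T / 4))) :
    ENNReal.ofReal (κ ^ 2 / 16) ≤ ∫⁻ B, batchRule A a η B {h | err D h ≤ α}
      ∂(Measure.pi fun _ : Fin T => sampleLaw D n) := by
  have hG : MeasurableSet {h : X → Bool | err D h ≤ α} :=
    measurableSet_le (measurable_err D) measurable_const
  have hGc : {h : X → Bool | err D h ≤ α}ᶜ = {h | α < err D h} := by
    ext h
    simp
  have hacc' : ∫⁻ S, A.posterior S {h : X → Bool | err D h ≤ α}ᶜ ∂(sampleLaw D n) ≤
      ENNReal.ofReal β := by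
    rw [← Measure.bind_apply hG.compl A.posterior.measurable.aemeasurable, hGc,
      ← ofReal_measureReal]
    exact ENNReal.ofReal_le_ofReal hacc
  have h1 := le_measure_heavy A.posterior (sampleLaw D n) (κ := κ) hG htv hacc'
  rw [← hκβ, two_mul, ENNReal.ofReal_add (by positivity) hβ, ENNReal.ofReal_add hκ hκ] at h1
  have h2 := (ENNReal.add_le_add_iff_right ENNReal.ofReal_ne_top).1
    ((ENNReal.add_le_add_iff_right ENNReal.ofReal_ne_top).1 h1)
  refine le_trans ?_ (le_lintegral_batchMechanism (h₀ := fun _ => false)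
    (measurableSet_hypograph A.posterior) measurable_fst (sampleLaw D n)
    (measurable_cover A.posterior _) hκ hT hκT ha hη hexp hG)
  -- Mean weight κ/16 at a heavy point, times measure κ of the heavy points over accurate
  -- classifiers.
  have h3 : κ ^ 2 / 16 = κ / 16 * κ := by ring
  rw [h3, ENNReal.ofReal_mul (by positivity)]
  gcongr
  exact h2

/-- Either all k + 1 independent batches fail, which gives the first term, or some candidate is good
and only the selection can fail. -/
theorem lintegral_privateRule_le (D : Measure (X × Bool)) [IsProbabilityMeasure D] {α γ p : ℝ}
    (hT : 0 < T) (hl : 0 ≤ l) (hlγ : l ≤ γ / 2) (hl1 : l ≤ 1) (hp : 0 ≤ p)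
    (hbatch : ENNReal.ofReal p ≤ ∫⁻ B, batchRule A a η B {h | err D h ≤ α}
      ∂(Measure.pi fun _ : Fin T => sampleLaw D n)) :
    ∫⁻ z : (Fin (k + 1) → Fin T → Sample X n) × Sample X M,
        privateRule A a η l z.1 z.2 {h | α + γ < err D h}
        ∂((Measure.pi fun _ : Fin (k + 1) => Measure.pi fun _ : Fin T => sampleLaw D n).prod
          (sampleLaw D M)) ≤
      ENNReal.ofReal ((1 - p) ^ (k + 1) + (k + 1) * Real.exp (-(l * γ / 2)) ^ M) := by
  have hprob := isProbabilityMeasure_batchRule A a η hT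
  set G : Set (X → Bool) := {h | err D h ≤ α}
  have hG : MeasurableSet G := measurableSet_le (measurable_err D) measurable_const
  have hbad : MeasurableSet {h : X → Bool | α + γ < err D h} :=
    measurableSet_lt measurable_const (measurable_err D)
  set c : ℝ≥0∞ := (k + 1) * ENNReal.ofReal (Real.exp (-(l * γ / 2))) ^ M
  have hN : MeasurableSet (univ.pi fun _ : Fin (k + 1) => Gᶜ) :=
    MeasurableSet.univ_pi fun _ => hG.compl
  have hsel : ∀ hs : Fin (k + 1) → X → Bool,
      ∫⁻ V : Sample X M, select l V hs {h | α + γ < err D h} ∂(sampleLaw D M) ≤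
        (univ.pi fun _ => Gᶜ).indicator 1 hs + c := by
    intro hs
    by_cases hgood : ∃ j, err D (hs j) ≤ α
    · exact (lintegral_select_le D hl hlγ hl1 hgood hbad).trans le_add_self
    · have hmem : hs ∈ univ.pi fun _ : Fin (k + 1) => Gᶜ := by
        intro j _ hj
        exact hgood ⟨j, hj⟩
      rw [indicator_of_mem hmem]
      refine le_trans ((lintegral_mono (g := fun _ => 1) fun V => ?_).trans (by simp)) le_self_add
      have := isProbabilityMeasure_select (l := l) V hs
      exact prob_le_one
  have hB : ∀ B : Fin (k + 1) → Fin T → Sample X n,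
      ∫⁻ V : Sample X M, privateRule A a η l B V {h | α + γ < err D h} ∂(sampleLaw D M) ≤
        ∏ j, batchRule A a η (B j) Gᶜ + c := by
    intro B
    simp_rw [privateRule_apply _ _ _ _ _ _ hbad]
    rw [lintegral_lintegral_swap (measurable_from_prod_countable_right fun V =>
      (Measure.measurable_coe hbad).comp (measurable_select V)).aemeasurable]
    refine (lintegral_mono hsel).trans ?_
    rw [lintegral_add_right _ measurable_const, lintegral_indicator_one hN, Measure.pi_pi]
    simp
  have hone : ∫⁻ B, batchRule A a η B Gᶜ ∂(Measure.pi fun _ : Fin T => sampleLaw D n) ≤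
      ENNReal.ofReal (1 - p) := by
    have h1 : ∀ B : Fin T → Sample X n, batchRule A a η B Gᶜ = 1 - batchRule A a η B G :=
      fun B => prob_compl_eq_one_sub hG
    have h2 : ∫⁻ B, batchRule A a η B Gᶜ ∂(Measure.pi fun _ : Fin T => sampleLaw D n) +
        ∫⁻ B, batchRule A a η B G ∂(Measure.pi fun _ : Fin T => sampleLaw D n) = 1 := by
      rw [← lintegral_add_left Measurable.of_discrete]
      simp_rw [h1, tsub_add_cancel_of_le prob_le_one]
      simp
    rw [ENNReal.ofReal_sub _ hp, ENNReal.ofReal_one]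
    refine ENNReal.le_sub_of_add_le_right ENNReal.ofReal_ne_top ?_
    rw [← h2]
    gcongr
  have hp1 : p ≤ 1 := by
    have h3 : ENNReal.ofReal p ≤ 1 := hbatch.trans
      ((lintegral_mono (g := fun _ => 1) fun B => prob_le_one).trans (by simp))
    simpa using h3
  rw [lintegral_prod _ Measurable.of_discrete.aemeasurable]
  refine (lintegral_mono hB).trans ?_
  rw [lintegral_add_right _ measurable_const, lintegral_pi_prod_eq_pow _
      (f := fun B => batchRule A a η B Gᶜ) Measurable.of_discrete,
    ENNReal.ofReal_add (by have : 0 ≤ 1 - p := by linarith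
                           positivity) (by positivity),
    ENNReal.ofReal_pow (by linarith), ENNReal.ofReal_mul (by positivity),
    ENNReal.ofReal_pow (Real.exp_pos _).le]
  refine add_le_add (pow_le_pow_left₀ zero_le hone _) (le_of_eq ?_)
  have hk : ENNReal.ofReal ((k : ℝ) + 1) = k + 1 := by
    rw [ENNReal.ofReal_add (by positivity) zero_le_one]
    simp
  rw [hk]
  simp [c]

theorem isDPLearner_privateLearner {H : Set (X → Bool)} {ρ α β κ : ℝ}
    (hA : IsTVLearner H A α β ρ) (hρ : 0 ≤ ρ) (hκ : 0 ≤ κ) (hβ : 0 ≤ β)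
    (hκβ : 2 * κ + β = 1 - ρ) {γ β' ε δ : ℝ} (hε : ε ∈ Ioo (0 : ℝ) 1) (hδ : 0 < δ) (hT : 0 < T) (hκT : 4 ≤ κ * T)
    (hexp : 1 ≤ δ / 24 * Real.exp (ε / 4 * (κ * T / 4))) (hl : 0 ≤ l) (hlε : 2 * l ≤ ε)
    (hlγ : l ≤ γ / 2)
    (hfail : (1 - κ ^ 2 / 16) ^ (k + 1) + (k + 1) * Real.exp (-(l * γ / 2)) ^ M ≤ β') {m : ℕ}
    (e : (Fin (k + 1) × Fin T × Fin n) ⊕ Fin M ≃ Fin m) :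
    IsDPLearner H (privateLearner A (δ / 24) (ε / 4) l hT e) (α + γ) β' ε δ := by
  refine ⟨differentiallyPrivate_privateLearner A l hT e hε hδ hl hlε, fun D hD hreal => ?_⟩
  obtain ⟨htv, hacc⟩ := hA D hD hreal
  have hbad : MeasurableSet {h : X → Bool | α + γ < err D h} :=
    measurableSet_lt measurable_const (measurable_err D)
  have h1 := lintegral_privateRule_le (k := k) (M := M) D hT hl hlγ (by linarith [hε.2])
    (by positivity) (le_lintegral_batchRule D hκ hβ hκβ htv hacc hT hκT (by positivity)
    (by linarith [hε.1]) hexp)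
  rw [← map_sampleLaw e D, lintegral_map Measurable.of_discrete Measurable.of_discrete] at h1
  have h2 : ((sampleLaw D m).bind (privateLearner A (δ / 24) (ε / 4) l hT e).posterior)
      {h | α + γ < err D h} ≤ ENNReal.ofReal β' := by
    rw [Measure.bind_apply hbad (Kernel.measurable _).aemeasurable]
    exact h1.trans (ENNReal.ofReal_le_ofReal hfail)
  refine ENNReal.toReal_le_of_le_ofReal (le_trans ?_ hfail) h2
  have h3 : κ ≤ 1 := by linarith
  have : 0 ≤ 1 - κ ^ 2 / 16 := by nlinarith
  positivity

end Private

/-! ### Numerical estimates for the sample size -/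

theorem one_lt_log_three : 1 < Real.log 3 := by
  rw [Real.lt_log_iff_exp_lt (by norm_num)]
  linarith [Real.exp_one_lt_d9]

/-- This constant bounds the logarithm in the second term of `sampleBlowup` from below, so additive
constants and rounding can be absorbed into the multiplicative constant. -/
theorem log_log_three_pos : 0 < Real.log (Real.log 3) := Real.log_pos one_lt_log_three

theorem log_three_le_log {β : ℝ} (hβ : β ∈ Ioo (0 : ℝ) 1) : Real.log 3 ≤ Real.log (3 / β) := by
  refine Real.log_le_log (by norm_num) ?_
  rw [le_div_iff₀ hβ.1]
  linarith [hβ.2]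

theorem log_log_three_le {β : ℝ} (hβ : β ∈ Ioo (0 : ℝ) 1) :
    Real.log (Real.log 3) ≤ Real.log (Real.log (3 / β) / β) := by
  have h1 := one_lt_log_three
  have h2 := log_three_le_log hβ
  refine Real.log_le_log (by linarith) ?_
  rw [le_div_iff₀ hβ.1]
  nlinarith [hβ.1, hβ.2]

theorem log_div_le_log_log {β δ : ℝ} (hβ : β ∈ Ioo (0 : ℝ) 1) (hδ : δ ∈ Ioo (0 : ℝ) 1) :
    Real.log (24 / δ) ≤
      4 / Real.log (Real.log 3) * Real.log (Real.log (3 / β) / (β * δ)) := by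
  have h1 := one_lt_log_three
  have h2 := log_three_le_log hβ
  have h0 := log_log_three_pos
  have hL : 0 < Real.log (3 / β) := by linarith
  have h3 : Real.log (Real.log (3 / β) / (β * δ)) =
      Real.log (Real.log (3 / β) / β) + Real.log (1 / δ) := by
    rw [← Real.log_mul (div_pos hL hβ.1).ne' (one_div_pos.2 hδ.1).ne']
    congr 1
    field_simp
  have h4 := log_log_three_le hβ
  have h5 : 0 ≤ Real.log (1 / δ) := Real.log_nonneg (by rw [le_div_iff₀ hδ.1]; linarith [hδ.2])
  have h6 : Real.log (24 / δ) = Real.log 24 + Real.log (1 / δ) := by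
    rw [← Real.log_mul (by norm_num) (one_div_pos.2 hδ.1).ne']
    congr 1
    field_simp
  have h7 : Real.log 24 ≤ 4 := by
    rw [Real.log_le_iff_le_exp (by norm_num)]
    have h8 : Real.exp 4 = Real.exp 1 ^ 4 := by rw [← Real.exp_nat_mul]; norm_num
    have h9 : (2.7 : ℝ) ^ 4 ≤ Real.exp 1 ^ 4 :=
      pow_le_pow_left₀ (by norm_num) (by linarith [Real.exp_one_gt_d9]) 4
    rw [h8]
    norm_num at h9 ⊢
    linarith
  have h10 : Real.log (Real.log 3) ≤ 1 := by
    have h11 : Real.log 3 ≤ 3 - 1 := Real.log_le_sub_one_of_pos (by norm_num)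
    have h12 := Real.log_le_sub_one_of_pos (show 0 < Real.log 3 by linarith)
    linarith
  rw [h3, h6, div_mul_eq_mul_div, le_div_iff₀ h0]
  nlinarith

/-- The maximum in the sample size is the cost of the single rate l = min(ε, α)/2 of the exponential
mechanism. -/
theorem div_min_mul {ε α : ℝ} (hε : 0 < ε) (hα : 0 < α) :
    1 / (min ε α * α) = max (1 / (ε * α)) (1 / α ^ 2) := by
  rcases le_total ε α with h | h
  · rw [min_eq_left h, max_eq_left]
    rw [sq]
    gcongr
  · rw [min_eq_right h, max_eq_right, sq]
    rw [sq]
    gcongr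

theorem one_sub_pow_le {p L : ℝ} {k : ℕ} (hp1 : p ≤ 1) (hk : L ≤ p * k) :
    (1 - p) ^ k ≤ Real.exp (-L) := by
  calc (1 - p) ^ k ≤ Real.exp (-p) ^ k :=
        pow_le_pow_left₀ (by linarith) (by linarith [Real.add_one_le_exp (-p)]) k
    _ = Real.exp (-(p * k)) := by rw [← Real.exp_nat_mul]; ring_nf
    _ ≤ _ := Real.exp_le_exp.2 (by linarith)

end PrivateLearning

end

/-! ### Choice of parameters and the sample count -/

set_option maxHeartbeats 1000000 in
theorem mainTheorem5 (ρ β : ℝ) (hρ : ρ ∈ Ioo (0 : ℝ) 1)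
    (hβ : β ∈ Ioo (0 : ℝ) ((1 - ρ) / (1 + ρ))) :
    ∃ C : ℝ, 0 < C ∧
      ∀ (X : Type*) [Countable X] [MeasurableSpace X] [MeasurableSingletonClass X]
        (H : Set (X → Bool)) (n : ℕ) (_hn : 1 ≤ n) (α : ℝ) (_hα : α ∈ Ioo (0 : ℝ) (1 / 2))
        (A : PrivateLearning.LearningRule X n) (_hA : PrivateLearning.IsTVLearner H A α β ρ)
        (α' β' ε δ : ℝ) (_hα' : α' ∈ Ioo (0 : ℝ) 1) (_hβ' : β' ∈ Ioo (0 : ℝ) 1)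
        (_hε : ε ∈ Ioo (0 : ℝ) 1) (_hδ : δ ∈ Ioo (0 : ℝ) 1),
        ∃ (m : ℕ) (A' : PrivateLearning.LearningRule X m),
          (m : ℝ) ≤ C * PrivateLearning.sampleBlowup α' β' ε δ * n ∧
          PrivateLearning.IsDPLearner H A' (α + α') β' ε δ := by
  obtain ⟨hρ0, hρ1⟩ := hρ
  obtain ⟨hβ0, hβ1⟩ := hβ
  have hβρ : β < 1 - ρ := hβ1.trans_le (div_le_self (by linarith) (by linarith))
  obtain ⟨κ, hκ⟩ : ∃ κ, κ = (1 - ρ - β) / 2 := ⟨_, rfl⟩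
  have hκ0 : 0 < κ := by linarith
  have hκ1 : κ < 1 := by linarith
  obtain ⟨p, hp⟩ : ∃ p, p = κ ^ 2 / 16 := ⟨_, rfl⟩
  have hp0 : 0 < p := by rw [hp]; positivity
  have hp1 : p ≤ 1 := by nlinarith
  obtain ⟨l₀, hl₀⟩ : ∃ l₀, l₀ = Real.log (Real.log 3) := ⟨_, rfl⟩
  have hl₀0 : 0 < l₀ := hl₀ ▸ PrivateLearning.log_log_three_pos
  -- K₁L will bound the number k + 1 of batches: since L ≥ 1, the summand 2 covers the ceiling and
  -- the extra batch.
  obtain ⟨K₁, hK₁⟩ : ∃ K₁, K₁ = 1 / p + 2 := ⟨_, rfl⟩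
  have hK₁2 : 2 ≤ K₁ := by rw [hK₁]; linarith [one_div_pos.2 hp0]
  obtain ⟨K₂, hK₂⟩ : ∃ K₂, K₂ = Real.log (3 * K₁) / l₀ + 1 := ⟨_, rfl⟩
  have hlogK : 0 ≤ Real.log (3 * K₁) := Real.log_nonneg (by linarith)
  have hK₂0 : 0 < K₂ := by rw [hK₂]; positivity
  -- 17 is the 16 in `T` plus 1 for rounding; 4/l₀ comes from `log_div_le_log_log`.
  obtain ⟨C₁, hC₁⟩ : ∃ C₁, C₁ = K₁ * (17 / κ) * (4 / l₀) := ⟨_, rfl⟩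
  obtain ⟨C₂, hC₂⟩ : ∃ C₂, C₂ = 4 * K₂ + 1 / l₀ := ⟨_, rfl⟩
  have hC₁0 : 0 < C₁ := by rw [hC₁]; positivity
  have hC₂0 : 0 < C₂ := by rw [hC₂]; positivity
  refine ⟨C₁ + C₂, by positivity, ?_⟩
  intro X _ _ _ H n hn α hα A hA α' β' ε δ hα' hβ' hε hδ
  have hε0 := hε.1
  have hα0 := hα'.1
  obtain ⟨L, hL⟩ : ∃ L, L = Real.log (3 / β') := ⟨_, rfl⟩
  have hL1 : 1 ≤ L :=
    hL ▸ (PrivateLearning.one_lt_log_three.trans_le (PrivateLearning.log_three_le_log hβ')).le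
  obtain ⟨Q, hQ⟩ : ∃ Q, Q = Real.log (L / (β' * δ)) := ⟨_, rfl⟩
  obtain ⟨U, hU⟩ : ∃ U, U = Real.log (L / β') := ⟨_, rfl⟩
  obtain ⟨E, hE⟩ : ∃ E, E = max (1 / (ε * α')) (1 / α' ^ 2) := ⟨_, rfl⟩
  obtain ⟨W, hW⟩ : ∃ W, W = Real.log (24 / δ) := ⟨_, rfl⟩
  have hU0 : l₀ ≤ U := by
    rw [hl₀, hU, hL]; exact PrivateLearning.log_log_three_le hβ'
  have hWQ : W ≤ 4 / l₀ * Q := by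
    rw [hW, hl₀, hQ, hL]; exact PrivateLearning.log_div_le_log_log hβ' hδ
  have hδ24 : 24 ≤ 24 / δ := by rw [le_div_iff₀ hδ.1]; linarith [hδ.2]
  have hW1 : 1 ≤ W := by
    rw [hW, Real.le_log_iff_exp_le (by linarith)]
    linarith [Real.exp_one_lt_d9]
  have hE1 : 1 ≤ E := by
    rw [hE]
    refine le_trans ?_ (le_max_right _ _)
    rw [le_div_iff₀ (by positivity), one_mul]
    exact pow_le_one₀ hα0.le hα'.2.le
  have hQ0 : 0 < Q := by
    by_contra h
    have : 4 / l₀ * Q ≤ 0 := mul_nonpos_of_nonneg_of_nonpos (by positivity) (not_lt.1 h)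
    linarith
  set l := min ε α' / 2 with hl
  have hl0 : 0 < l := by rw [hl]; have := lt_min hε0 hα0; positivity
  have hlE : 2 / (l * α') = 4 * E := by
    rw [hE, ← PrivateLearning.div_min_mul hε0 hα0, hl]
    have := lt_min hε0 hα0
    field_simp
    norm_num
  set k := ⌈L / p⌉₊ with hk
  -- Chosen so that (ε/4)(κT/4) ≥ log(24/δ), which saturates the exponential at the count κT/4.
  set T := ⌈16 / (κ * ε) * W⌉₊ with hT
  set M := ⌈4 * E * Real.log (3 * K₁ * L / β')⌉₊ with hM
  have hk1 : L / p ≤ k := Nat.le_ceil _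
  have hk2 : (k : ℝ) + 1 ≤ K₁ * L := by
    have := (Nat.ceil_lt_add_one (by positivity : 0 ≤ L / p)).le
    rw [← hk] at this
    rw [hK₁, add_mul, one_div_mul_eq_div]
    linarith
  have hT1 : 16 / (κ * ε) * W ≤ T := Nat.le_ceil _
  have hκε : 1 ≤ 1 / (κ * ε) := by
    rw [le_div_iff₀ (by positivity), one_mul]
    exact mul_le_one₀ hκ1.le hε0.le hε.2.le
  have hT2 : (T : ℝ) ≤ 17 / (κ * ε) * W := by
    have h1 := (Nat.ceil_lt_add_one (by positivity : 0 ≤ 16 / (κ * ε) * W)).le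
    have h2 : 1 ≤ 1 / (κ * ε) * W := one_le_mul_of_one_le_of_one_le hκε hW1
    have h3 : 17 / (κ * ε) * W = 16 / (κ * ε) * W + 1 / (κ * ε) * W := by ring
    linarith
  have hκεT : 16 * W ≤ κ * ε * T := by
    rw [div_mul_eq_mul_div, div_le_iff₀ (by positivity)] at hT1
    linarith
  have hT0 : 0 < T := by
    rw [hT, Nat.ceil_pos]
    positivity
  have hlog : Real.log (3 * K₁ * L / β') = Real.log (3 * K₁) + U := by
    rw [hU, ← Real.log_mul (by positivity) (div_pos (by linarith) hβ'.1).ne', mul_div_assoc]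
  have hM1 : 4 * E * Real.log (3 * K₁ * L / β') ≤ M := Nat.le_ceil _
  have hM2 : (M : ℝ) ≤ C₂ * (U * E) := by
    have h0 : 0 ≤ 4 * E * Real.log (3 * K₁ * L / β') := by
      rw [hlog]
      have : 0 ≤ Real.log (3 * K₁) + U := by linarith
      positivity
    have h1 := (Nat.ceil_lt_add_one h0).le
    rw [hlog] at h1
    have h2 : Real.log (3 * K₁) + U ≤ K₂ * U := by
      rw [hK₂, add_mul, one_mul, div_mul_eq_mul_div]
      have : Real.log (3 * K₁) ≤ Real.log (3 * K₁) * U / l₀ := by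
        rw [le_div_iff₀ hl₀0]
        gcongr
      linarith
    have h3 : 1 ≤ 1 / l₀ * (U * E) := by
      rw [one_div_mul_eq_div, le_div_iff₀ hl₀0, one_mul]
      exact hU0.trans (le_mul_of_one_le_right (hl₀0.le.trans hU0) hE1)
    calc (M : ℝ) ≤ 4 * E * (Real.log (3 * K₁) + U) + 1 := by rw [hM, hlog]; exact h1
      _ ≤ 4 * E * (K₂ * U) + 1 / l₀ * (U * E) := by gcongr
      _ = _ := by rw [hC₂]; ring
  have hβexp : Real.exp (-L) = β' / 3 := by
    rw [hL, Real.exp_neg, Real.exp_log (div_pos (by norm_num) hβ'.1), inv_div]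
  -- Each of the two failures takes at most β'/3; `M` is chosen so that a union over at most K₁L
  -- candidates fits the second share.
  have hfail : (1 - κ ^ 2 / 16) ^ (k + 1) + (k + 1) * Real.exp (-(l * α' / 2)) ^ M ≤ β' := by
    have h1 : (1 - κ ^ 2 / 16) ^ (k + 1) ≤ β' / 3 := by
      rw [← hp, ← hβexp]
      refine PrivateLearning.one_sub_pow_le hp1 ?_
      rw [div_le_iff₀ hp0] at hk1
      push_cast
      linarith
    have h2 : Real.exp (-(l * α' / 2)) ^ M ≤ β' / (3 * K₁ * L) := by
      have h3 : Real.log (3 * K₁ * L / β') ≤ M * (l * α' / 2) := by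
        rw [← hlE, div_mul_eq_mul_div, div_le_iff₀ (by positivity)] at hM1
        linarith
      rw [← Real.exp_nat_mul, ← inv_div (3 * K₁ * L), ← Real.exp_log (div_pos (by positivity) hβ'.1 :
        0 < 3 * K₁ * L / β'), ← Real.exp_neg]
      exact Real.exp_le_exp.2 (by linarith)
    have h4 : ((k : ℝ) + 1) * Real.exp (-(l * α' / 2)) ^ M ≤ β' / 3 := by
      calc _ ≤ (K₁ * L) * (β' / (3 * K₁ * L)) := by gcongr
        _ = β' / 3 := by field_simp
    linarith [hβ'.1]
  have hexp : 1 ≤ δ / 24 * Real.exp (ε / 4 * (κ * T / 4)) := by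
    have h1 : 24 / δ ≤ Real.exp (ε / 4 * (κ * T / 4)) := by
      rw [← Real.log_le_iff_le_exp (by linarith), ← hW]
      linarith
    have h2 := hδ.1
    calc (1 : ℝ) = δ / 24 * (24 / δ) := by field_simp
      _ ≤ _ := by gcongr
  have hκT : 4 ≤ κ * T := by
    have h1 : κ * ε * T ≤ κ * T := by
      rw [mul_right_comm]
      exact mul_le_of_le_one_right (by positivity) hε.2.le
    linarith
  have hlε : 2 * l ≤ ε := by rw [hl]; linarith [min_le_left ε α']
  have hlα : l ≤ α' / 2 := by rw [hl]; linarith [min_le_right ε α']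
  let e : (Fin (k + 1) × Fin T × Fin n) ⊕ Fin M ≃ Fin ((k + 1) * (T * n) + M) :=
    Fintype.equivFinOfCardEq (by simp)
  refine ⟨_, PrivateLearning.privateLearner A (δ / 24) (ε / 4) l hT0 e, ?_,
    PrivateLearning.isDPLearner_privateLearner hA hρ0.le hκ0.le hβ0.le (by linarith) hε hδ.1 hT0
      hκT hexp hl0.le hlε hlα hfail e⟩
  have hn' : (1 : ℝ) ≤ n := by exact_mod_cast hn
  have hblow : PrivateLearning.sampleBlowup α' β' ε δ = L * Q / ε + U * E := by
    rw [PrivateLearning.sampleBlowup, ← hL, ← hQ, ← hU, ← hE]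
  have hUE : 0 < U * E := mul_pos (by linarith) (by linarith)
  rw [hblow]
  push_cast
  calc ((k : ℝ) + 1) * (T * n) + M
      ≤ (K₁ * L) * ((17 / (κ * ε) * (4 / l₀ * Q)) * n) + C₂ * (U * E) * n := by
        refine add_le_add ?_ (hM2.trans (le_mul_of_one_le_right (by positivity) hn'))
        gcongr
        exact hT2.trans (by gcongr)
    _ = (C₁ * (L * Q / ε) + C₂ * (U * E)) * n := by
        rw [hC₁]
        field_simp
    _ ≤ (C₁ + C₂) * (L * Q / ε + U * E) * n := by
        refine mul_le_mul_of_nonneg_right ?_ (by linarith)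
        have h1 : 0 ≤ L * Q / ε := by positivity
        have h2 : 0 ≤ C₁ * (U * E) := by positivity
        have h3 : 0 ≤ C₂ * (L * Q / ε) := by positivity
        linarith
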